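/- Let $\mathbb{T}^2=(\mathbb{C}^*)^2$. A *double Segre surface* is a surface $X\subset\mathbb{P}^8$ together with a biregular isomorphism $\varphi\colon\mathbb{P}^1\times\mathbb{P}^1\to X$ whose components form a basis of the forms of bidegree $(2,2)$. A *Veronese surface* is a surface $X\subset\mathbb{P}^5$ together with a biregular isomorphism $\varphi\colon\mathbb{P}^2\to X$ whose components form a basis of the forms of degree $2$. A *toric parametrization* of $X\subset\mathbb{P}^n$ is an injective map $p\colon\mathbb{T}^2\to X$ with Zariski dense image which, up to a projective equivalence of $\mathbb{P}^n$, is a monomial parametrization $t\mapsto(t^{e_0}:\dots:t^{e_n})$ with $e_i\in\mathbb{Z}^2$; its *lattice polygon* is the convex hull of $e_0,\dots,e_n$ in $\mathbb{R}^2$. An antiholomorphic involution $\sigma\colon X\to X$ *acts as* the unimodular involution $M\in\operatorname{GL}(2,\mathbb{Z})$ of a lattice polygon $\Lambda$ if, for some toric parametrization $p$ of $X$, there are $\tau\colon\mathbb{T}^2\to\mathbb{T}^2$ and an integer matrix $N$ such that $\sigma\circ p=p\circ\tau$ and $\tau(t)^v=\overline{t^{Nv}}$ for all $v\in\mathbb{Z}^2$,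 $t\in\mathbb{T}^2$ (so $\tau$ is compatible with the group structure of $\mathbb{T}^2$; in particular $\tau(1,1)=(1,1)$), and there are $A\in\operatorname{GL}(2,\mathbb{Z})$ and $c\in\mathbb{Z}^2$ such that $x\mapsto Ax+c$ maps the lattice polygon of $p$ onto $\Lambda$ and $AN=MA$. Two self-maps $\sigma,\sigma'$ of $X$ are *inner automorphic via* $\operatorname{Aut}(Z)$, where $\varphi\colon Z\to X$ is the isomorphism above, if $\gamma^{-1}\circ\sigma\circ\gamma=\sigma'$ for some $\gamma=\varphi\circ\alpha\circ\varphi^{-1}$ with $\alpha$ a complex biregular automorphism of $Z$. (a) Let $X$ be a double Segre surface. Any two antiholomorphic involutions of $X$, each of which acts on the square with vertices $(\pm1,\pm1)$ as one of the unimodular involutions $(x,y)\mapsto(x,y)$, $(x,y)\mapsto(-x,y)$, $(x,y)\mapsto(-x,-y)$, are inner automorphic via $\operatorname{Aut}(\mathbb{P}^1\times\mathbb{P}^1)$. Moreover each of them is inner automorphic to the involution of $X$ that corresponds under $\varphi$ to $(s:t;u:w)\mapsto(\overline{s}:\overline{t};\overline{u}:\overline{w})$. (b) Let $X$ be a Veronese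 surface. Any two antiholomorphic involutions of $X$, each of which acts on the triangle with vertices $(-1,1),(1,-1),(-1,-1)$ as one of the unimodular involutions $(x,y)\mapsto(x,y)$, $(x,y)\mapsto(y,x)$, are inner automorphic via $\operatorname{Aut}(\mathbb{P}^2)$. Moreover each of them is inner automorphic to the involution of $X$ that corresponds under $\varphi$ to $(s:t:u)\mapsto(\overline{s}:\overline{t}:\overline{u})$. -/

import Mathlib

noncomputable section

namespace RealToric

/-- Complex projective `n`-space. -/
abbrev CP (n : ℕ) := Projectivization ℂ (Fin (n + 1) → ℂ)

/-! ### Regular maps and automorphism groups -/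

/-- A map `ℙⁿ → ℙᵐ` is regular if near each point (in the Zariski topology) it is given by
homogeneous polynomials of one common degree that do not vanish simultaneously at the point. -/
def IsRegularMap {n m : ℕ} (f : CP n → CP m) : Prop :=
  ∀ v : Fin (n + 1) → ℂ, v ≠ 0 →
    ∃ (d : ℕ) (F : Fin (m + 1) → MvPolynomial (Fin (n + 1)) ℂ),
      (∀ i, (F i).IsHomogeneous d) ∧
      (fun i => MvPolynomial.eval v (F i)) ≠ 0 ∧
      ∀ (w : Fin (n + 1) → ℂ) (hw : w ≠ 0) (h : (fun i => MvPolynomial.eval w (F i)) ≠ 0),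
        f (Projectivization.mk ℂ w hw) = Projectivization.mk ℂ _ h

/-- The bigrading on `ℂ[s,t;u,w]`: `s, t` have bidegree `(1,0)`, `u, w` have bidegree `(0,1)`. -/
def biWeight : Fin 2 ⊕ Fin 2 → ℕ × ℕ := Sum.elim (fun _ => (1, 0)) (fun _ => (0, 1))

/-- A map `ℙ¹ × ℙ¹ → ℙᵐ` is regular if near each point (in the Zariski topology) it is given by
bihomogeneous polynomials of one common bidegree that do not vanish simultaneously there. -/
def IsBiregularlyDefined {m : ℕ} (f : CP 1 × CP 1 → CP m) : Prop :=
  ∀ v w : Fin 2 → ℂ, v ≠ 0 → w ≠ 0 →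
    ∃ (d : ℕ × ℕ) (F : Fin (m + 1) → MvPolynomial (Fin 2 ⊕ Fin 2) ℂ),
      (∀ i, (F i).IsWeightedHomogeneous biWeight d) ∧
      (fun i => MvPolynomial.eval (Sum.elim v w) (F i)) ≠ 0 ∧
      ∀ (v' w' : Fin 2 → ℂ) (hv : v' ≠ 0) (hw : w' ≠ 0)
        (h : (fun i => MvPolynomial.eval (Sum.elim v' w') (F i)) ≠ 0),
        f (Projectivization.mk ℂ v' hv, Projectivization.mk ℂ w' hw) =
          Projectivization.mk ℂ _ h

/-- `Aut(ℙ²)`: the biregular automorphisms of the complex projective plane. -/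
def AutP2 : Set (Equiv.Perm (CP 2)) :=
  {α | IsRegularMap α ∧ IsRegularMap α.symm}

/-- A map of `ℙ¹ × ℙ¹` to itself is regular if both of its components are. -/
def IsRegularSelfMap (f : CP 1 × CP 1 → CP 1 × CP 1) : Prop :=
  IsBiregularlyDefined (fun x => (f x).1) ∧ IsBiregularlyDefined (fun x => (f x).2)

/-- `Aut(ℙ¹ × ℙ¹)`: the biregular automorphisms of the complex surface `ℙ¹ × ℙ¹`. -/
def AutP1P1 : Set (Equiv.Perm (CP 1 × CP 1)) :=
  {α | IsRegularSelfMap α ∧ IsRegularSelfMap α.symm}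

/-! ### Double Segre surfaces and Veronese surfaces -/

/-- `φ` is a bijection from `ℙ¹ × ℙ¹` onto `X ⊆ ℙ⁸` whose components form a basis of the vector
space of forms of bidegree `(2,2)`; thus `X` is a double Segre surface, with
parametrization `φ`. -/
def IsDoubleSegre {X : Set (CP 8)} (φ : CP 1 × CP 1 ≃ X) : Prop :=
  ∃ F : Fin 9 → MvPolynomial (Fin 2 ⊕ Fin 2) ℂ,
    LinearIndependent ℂ F ∧
    Submodule.span ℂ (Set.range F) =
      MvPolynomial.weightedHomogeneousSubmodule ℂ biWeight (2, 2) ∧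
    ∀ (v w : Fin 2 → ℂ) (hv : v ≠ 0) (hw : w ≠ 0),
      ∃ h : (fun i => MvPolynomial.eval (Sum.elim v w) (F i)) ≠ 0,
        (φ (Projectivization.mk ℂ v hv, Projectivization.mk ℂ w hw) : CP 8) =
          Projectivization.mk ℂ _ h

/-- `φ` is a bijection from `ℙ²` onto `X ⊆ ℙ⁵` whose components form a basis of the vector space
of forms of degree `2`; thus `X` is a Veronese surface, with parametrization `φ`. -/
def IsVeronese {X : Set (CP 5)} (φ : CP 2 ≃ X) : Prop :=
  ∃ F : Fin 6 → MvPolynomial (Fin 3) ℂ,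
    LinearIndependent ℂ F ∧
    Submodule.span ℂ (Set.range F) = MvPolynomial.homogeneousSubmodule (Fin 3) ℂ 2 ∧
    ∀ (v : Fin 3 → ℂ) (hv : v ≠ 0),
      ∃ h : (fun i => MvPolynomial.eval v (F i)) ≠ 0,
        (φ (Projectivization.mk ℂ v hv) : CP 5) = Projectivization.mk ℂ _ h

/-! ### Antiholomorphic involutions -/

/-- A self-map of `X ⊆ ℙⁿ` is antiholomorphic if locally (in the classical topology) it is given
in homogeneous coordinates by complex conjugates of holomorphic functions. -/
def IsAntiholomorphic {n : ℕ} {X : Set (CP n)} (σ : X → X) : Prop :=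
  ∀ (v : Fin (n + 1) → ℂ) (hv : v ≠ 0), Projectivization.mk ℂ v hv ∈ X →
    ∃ (U : Set (Fin (n + 1) → ℂ)) (F : (Fin (n + 1) → ℂ) → (Fin (n + 1) → ℂ)),
      IsOpen U ∧ v ∈ U ∧ DifferentiableOn ℂ F U ∧
      ∀ (w : Fin (n + 1) → ℂ) (hw : w ≠ 0) (hX : Projectivization.mk ℂ w hw ∈ X), w ∈ U →
        ∃ h : (fun i => starRingEnd ℂ (F w i)) ≠ 0,
          (σ ⟨Projectivization.mk ℂ w hw, hX⟩ : CP n) = Projectivization.mk ℂ _ h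

/-- A real structure, that is, an antiholomorphic involution. -/
def IsAntiholomorphicInvolution {n : ℕ} {X : Set (CP n)} (σ : X → X) : Prop :=
  Function.Involutive σ ∧ IsAntiholomorphic σ

/-- Coordinatewise complex conjugation of vectors. -/
def conjVec (n : ℕ) : (Fin n → ℂ) →ₛₗ[starRingEnd ℂ] (Fin n → ℂ) where
  toFun v i := starRingEnd ℂ (v i)
  map_add' _ _ := by ext i; simp
  map_smul' _ _ := by ext i; simp

theorem conjVec_injective (n : ℕ) : Function.Injective (conjVec n) := fun _ _ h =>
  funext fun i => (starRingEnd ℂ).injective (congrFun h i)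

/-- The real structure `(x₀ : … : xₙ) ↦ (x̄₀ : … : x̄ₙ)` of `ℙⁿ`. -/
def conjP (n : ℕ) : CP n → CP n :=
  Projectivization.map (conjVec (n + 1)) (conjVec_injective (n + 1))

/-- Let `φ` identify `Z` with `X` and let `A` be a group of automorphisms of `Z`. The self-maps
`σ` and `σ'` of `X` are inner automorphic via `A` if `γ⁻¹ ∘ σ ∘ γ = σ'` for the automorphism
`γ = φ ∘ α ∘ φ⁻¹` of `X` corresponding to some `α ∈ A`. -/
def InnerAutomorphicVia {Z X : Type*} (φ : Z ≃ X) (A : Set (Equiv.Perm Z)) (σ σ' : X → X) :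
    Prop :=
  ∃ α ∈ A, (φ.permCongr α).symm ∘ σ ∘ φ.permCongr α = σ'

/-! ### Toric structures and lattice types -/

/-- The algebraic torus `𝕋² = (ℂ^*)²`. -/
abbrev Torus := Fin 2 → ℂˣ

/-- The Laurent monomial `t₀ ^ v₀ * t₁ ^ v₁`. -/
def character (v : Fin 2 → ℤ) (t : Torus) : ℂ := ((∏ j, t j ^ v j : ℂˣ) : ℂ)

/-- `p : 𝕋² → X` is, up to the projective equivalence `g`, the monomial parametrization with
exponents `e`, it is injective, and its image is Zariski dense in `X`. -/
structure IsToricParametrization {n : ℕ} {X : Set (CP n)} (e : Fin (n + 1) → Fin 2 → ℤ)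
    (g : GL (Fin (n + 1)) ℂ) (p : Torus → X) : Prop where
  monomial : ∀ t : Torus,
    ∃ h : (g : Matrix (Fin (n + 1)) (Fin (n + 1)) ℂ).mulVec (fun i => character (e i) t) ≠ 0,
      (p t : CP n) = Projectivization.mk ℂ _ h
  injective : Function.Injective p
  dense : ∀ (d : ℕ) (f : MvPolynomial (Fin (n + 1)) ℂ), f.IsHomogeneous d →
    (∀ t, MvPolynomial.eval (p t : CP n).rep f = 0) →
      ∀ x ∈ X, MvPolynomial.eval (Projectivization.rep x) f = 0

/-- The lattice polygon: the convex hull of the exponents. -/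
def latticePolygon {n : ℕ} (e : Fin (n + 1) → Fin 2 → ℤ) : Set (Fin 2 → ℝ) :=
  convexHull ℝ (Set.range fun i j => (e i j : ℝ))

/-- The antiholomorphic map `τ` of the torus induces the linear map `N` of the lattice `ℤ²` of
characters: pulling back the character `v` along `τ` gives the complex conjugate of the
character `N v`. (This makes `τ` compatible with the group structure of the torus; in
particular `τ` fixes the unit.) -/
def Induces (τ : Torus → Torus) (N : Matrix (Fin 2) (Fin 2) ℤ) : Prop :=
  ∀ (v : Fin 2 → ℤ) (t : Torus), character v (τ t) = starRingEnd ℂ (character (N.mulVec v) t)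

/-- There is a unimodular isomorphism (a translation by a lattice vector composed with an element
of `GL(2,ℤ)`) between the polygons `P` and `Q` which is compatible with the linear maps `N` and
`M` of the lattice. -/
def LatticeEquivalent (P : Set (Fin 2 → ℝ)) (N : Matrix (Fin 2) (Fin 2) ℤ)
    (Q : Set (Fin 2 → ℝ)) (M : Matrix (Fin 2) (Fin 2) ℤ) : Prop :=
  ∃ (A : GL (Fin 2) ℤ) (c : Fin 2 → ℤ),
    (fun x : Fin 2 → ℝ =>
      ((A : Matrix (Fin 2) (Fin 2) ℤ).map (Int.cast : ℤ → ℝ)).mulVec x +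
        fun j => (c j : ℝ)) '' P = Q ∧
    (A : Matrix (Fin 2) (Fin 2) ℤ) * N = M * (A : Matrix (Fin 2) (Fin 2) ℤ)

/-- The self-map `σ` of `X` acts as the unimodular involution `M` of the lattice polygon `Q`: for
some toric parametrization of `X`, the map `σ` restricts to a map of the torus, and the lattice
polygon together with the induced map of the lattice is equivalent to `Q` together with `M`. -/
def ActsAs {n : ℕ} {X : Set (CP n)} (σ : X → X) (Q : Set (Fin 2 → ℝ))
    (M : Matrix (Fin 2) (Fin 2) ℤ) : Prop :=
  ∃ (e : Fin (n + 1) → Fin 2 → ℤ) (g : GL (Fin (n + 1)) ℂ) (p : Torus → X)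
    (τ : Torus → Torus) (N : Matrix (Fin 2) (Fin 2) ℤ),
    IsToricParametrization e g p ∧ (∀ t, σ (p t) = p (τ t)) ∧ Induces τ N ∧
      LatticeEquivalent (latticePolygon e) N Q M

/-- The square with vertices `(±1, ±1)`. -/
def squarePolygon : Set (Fin 2 → ℝ) :=
  convexHull ℝ {![-1, 1], ![1, 1], ![1, -1], ![-1, -1]}

/-- The triangle with vertices `(-1, 1)`, `(1, -1)`, `(-1, -1)`. -/
def trianglePolygon : Set (Fin 2 → ℝ) :=
  convexHull ℝ {![-1, 1], ![1, -1], ![-1, -1]}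

/-- The antiholomorphic involutions of `X` that act on the square with vertices `(±1, ±1)` as the
identity, as the reflection `(x, y) ↦ (-x, y)` or as the rotation `(x, y) ↦ (-x, -y)`. -/
def squareInvolutions (X : Set (CP 8)) : Set (X → X) :=
  {σ | IsAntiholomorphicInvolution σ ∧
    (ActsAs σ squarePolygon !![1, 0; 0, 1] ∨ ActsAs σ squarePolygon !![-1, 0; 0, 1] ∨
      ActsAs σ squarePolygon !![-1, 0; 0, -1])}

/-- The antiholomorphic involutions of `X` that act on the triangle with vertices `(-1, 1)`,
`(1, -1)`, `(-1, -1)` as the identity or as the reflection `(x, y) ↦ (y, x)`. -/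
def triangleInvolutions (X : Set (CP 5)) : Set (X → X) :=
  {σ | IsAntiholomorphicInvolution σ ∧
    (ActsAs σ trianglePolygon !![1, 0; 0, 1] ∨ ActsAs σ trianglePolygon !![0, 1; 1, 0])}

end RealToric

end

noncomputable section

namespace RealToric

open Filter Topology

/-! ### Projective transformations -/

/-! The plan is to show that every involution in question becomes standard coordinatewise
conjugation in a suitable parametrization of `X`, projectively equivalent to the given `φ`. Two such
parametrizations `ψ`, `ψ'` differ by `ψ ∘ ψ'⁻¹`, which is linear in the ambient coordinates. It
therefore comes from a regular automorphism of the source and conjugates one involution to the other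
(`innerAutomorphicVia_of_equivariant`). The standard structure is the case `ψ' = φ`.

To find the parametrization, use the toric data. Nondegeneracy of `X` forces the exponents to be
distinct. The square has exactly 9 lattice points and the triangle exactly 6, so the exponents are
all lattice points of the polygon. After a unimodular change of torus coordinates, `σ` acts on the
torus orbit by conjugating the coordinates and permuting them as `M` permutes lattice points
(`ActsAs.exists_normal_form`).

This description extends from the orbit to all of `X`. The model surface is cut out by binomial
quadrics and is the closure of the orbit. Density thus identifies `X` with a linear image of the
model (`IsToricModel.exists_parametrization`), and continuity of `σ` gives its formula everywhere
(`IsToricModel.antiholomorphic_eq`).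

Finally, each permutation that occurs is induced by the identity or a swap of two homogeneous
coordinates of the plane or of a line. The swapped conjugation has real points `(z : z̄)`, and the
substitution `(x + iy, x - iy)` turns it into ordinary conjugation (`Straightens`). -/

/-- The projective space of the coordinate space `ℂ^I`. -/
abbrev CoordP (I : Type*) := Projectivization ℂ (I → ℂ)

section Projective

variable {I J K : Type*}

/-- Proportionality is expressed by the vanishing of all `2 × 2` minors. Unlike the existence of a
scalar, this condition passes to limits. -/
theorem mk_eq_mk_of_mul_eq {u w : I → ℂ} (hu : u ≠ 0) (hw : w ≠ 0)
    (h : ∀ i j, u i * w j = u j * w i) :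
    Projectivization.mk ℂ u hu = Projectivization.mk ℂ w hw := by
  obtain ⟨j, hj⟩ := Function.ne_iff.mp hw
  rw [Projectivization.mk_eq_mk_iff']
  refine ⟨u j / w j, funext fun i => ?_⟩
  simp only [Pi.zero_apply] at hj
  rw [Pi.smul_apply, smul_eq_mul, div_mul_eq_mul_div, ← h i j, mul_div_cancel_right₀ _ hj]

/-- The projective transformation given by a linear isomorphism. -/
def projMap (T : (I → ℂ) ≃ₗ[ℂ] (J → ℂ)) : CoordP I → CoordP J :=
  Projectivization.map T.toLinearMap T.injective

/-- Multiplication of vectors by an invertible matrix, after a relabelling of the coordinates. -/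
def reindexMulVec {m : ℕ} (E : Fin m ≃ I) (g : GL (Fin m) ℂ) : (I → ℂ) ≃ₗ[ℂ] (Fin m → ℂ) :=
  (LinearEquiv.funCongrLeft ℂ ℂ E).trans
    (Matrix.toLin'OfInv (M := g⁻¹.val) (M' := g.val)
      (by rw [← Units.val_mul]; simp) (by rw [← Units.val_mul]; simp))

theorem reindexMulVec_apply {m : ℕ} (E : Fin m ≃ I) (g : GL (Fin m) ℂ) (y : I → ℂ) :
    reindexMulVec E g y = (g : Matrix (Fin m) (Fin m) ℂ).mulVec fun i => y (E i) := rfl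

theorem projMap_mk (T : (I → ℂ) ≃ₗ[ℂ] (J → ℂ)) (v : I → ℂ) (hv : v ≠ 0) :
    projMap T (Projectivization.mk ℂ v hv) =
      Projectivization.mk ℂ (T v) ((map_ne_zero_iff T T.injective).mpr hv) :=
  Projectivization.map_mk _ _ _ _

theorem projMap_trans (T : (I → ℂ) ≃ₗ[ℂ] (J → ℂ)) (S : (J → ℂ) ≃ₗ[ℂ] (K → ℂ)) (x : CoordP I) :
    projMap (T.trans S) x = projMap S (projMap T x) := by
  induction x using Projectivization.ind with | h v hv => simp only [projMap_mk]; rfl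

theorem projMap_symm_projMap (T : (I → ℂ) ≃ₗ[ℂ] (J → ℂ)) (x : CoordP I) :
    projMap T.symm (projMap T x) = x := by
  induction x using Projectivization.ind with | h v hv => simp [projMap_mk]

theorem projMap_projMap_symm (T : (I → ℂ) ≃ₗ[ℂ] (J → ℂ)) (x : CoordP J) :
    projMap T (projMap T.symm x) = x :=
  projMap_symm_projMap T.symm x

theorem projMap_injective (T : (I → ℂ) ≃ₗ[ℂ] (J → ℂ)) : Function.Injective (projMap T) :=
  Projectivization.map_injective (τ := RingHom.id ℂ) _ _

/-- The antilinear map `y ↦ conj ∘ y ∘ π` of `ℂ^I`. -/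
def conjPerm (π : Equiv.Perm I) : (I → ℂ) →ₛₗ[starRingEnd ℂ] (I → ℂ) where
  toFun y i := starRingEnd ℂ (y (π i))
  map_add' _ _ := by ext i; simp
  map_smul' _ _ := by ext i; simp

theorem conjPerm_apply (π : Equiv.Perm I) (y : I → ℂ) (i : I) :
    conjPerm π y i = starRingEnd ℂ (y (π i)) := rfl

theorem conjPerm_injective (π : Equiv.Perm I) : Function.Injective (conjPerm π) := by
  intro y y' h
  funext i
  have := congrFun h (π.symm i)
  exact (starRingEnd ℂ).injective (by simpa [conjPerm_apply] using this)

/-- The antiholomorphic transformation of projective space given by `conjPerm π`. -/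
def projConjPerm (π : Equiv.Perm I) : CoordP I → CoordP I :=
  Projectivization.map (conjPerm π) (conjPerm_injective π)

theorem projConjPerm_mk (π : Equiv.Perm I) (v : I → ℂ) (hv : v ≠ 0) :
    projConjPerm π (Projectivization.mk ℂ v hv) =
      Projectivization.mk ℂ (conjPerm π v)
        ((map_ne_zero_iff (conjPerm π) (conjPerm_injective π)).mpr hv) :=
  Projectivization.map_mk _ _ _ _

end Projective

/-! ### Characters of the torus -/

theorem character_ne_zero (v : Fin 2 → ℤ) (t : Torus) : character v t ≠ 0 := Units.ne_zero _

theorem character_add (v w : Fin 2 → ℤ) (t : Torus) :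
    character (v + w) t = character v t * character w t := by
  simp [character, zpow_add]; ring

theorem character_neg (v : Fin 2 → ℤ) (t : Torus) :
    character (-v) t = (character v t)⁻¹ := by
  simp [character, mul_comm]

/-- The endomorphism of the torus whose pullback of characters is the linear map `B`. -/
def torusHom (B : Matrix (Fin 2) (Fin 2) ℤ) (t : Torus) : Torus := fun j => ∏ k, t k ^ B k j

theorem character_torusHom (B : Matrix (Fin 2) (Fin 2) ℤ) (v : Fin 2 → ℤ) (t : Torus) :
    character v (torusHom B t) = character (B.mulVec v) t := by
  have hB : ∀ k, B.mulVec v k = B k 0 * v 0 + B k 1 * v 1 := fun k => by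
    simp [Matrix.mulVec, dotProduct]
  refine congrArg Units.val ?_
  simp only [torusHom, Fin.prod_univ_two, hB, mul_zpow, zpow_add, zpow_mul]
  ac_rfl

theorem torus_ext {t s : Torus} (h : ∀ v, character v t = character v s) : t = s := by
  funext j
  have := h (Pi.single j 1)
  fin_cases j <;> simpa [character, Units.ext_iff] using this

theorem torusHom_surjective (A : GL (Fin 2) ℤ) :
    Function.Surjective (torusHom (A : Matrix (Fin 2) (Fin 2) ℤ)) := by
  intro t
  refine ⟨torusHom (A⁻¹ : GL (Fin 2) ℤ) t, torus_ext fun v => ?_⟩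
  rw [character_torusHom, character_torusHom, Matrix.mulVec_mulVec, ← Units.val_mul]
  simp

/-- The point of the affine toric cone with exponents `f` given by a point of the torus. -/
def torusVec {I : Type*} (f : I → Fin 2 → ℤ) (t : Torus) : I → ℂ := fun i => character (f i) t

theorem torusVec_ne_zero {I : Type*} [Nonempty I] (f : I → Fin 2 → ℤ) (t : Torus) :
    torusVec f t ≠ 0 := fun h =>
  character_ne_zero _ t (congrFun h (Classical.arbitrary I))

/-- The torus point `torusVec f t`, as a point of projective space. -/
def torusPoint {I : Type*} [Nonempty I] (f : I → Fin 2 → ℤ) (t : Torus) : CoordP I :=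
  Projectivization.mk ℂ (torusVec f t) (torusVec_ne_zero f t)

/-- The image of `p` is Zariski dense in `X`. -/
def HasDenseImage {n : ℕ} {X : Set (CP n)} (p : Torus → X) : Prop :=
  ∀ (d : ℕ) (f : MvPolynomial (Fin (n + 1)) ℂ), f.IsHomogeneous d →
    (∀ t, MvPolynomial.eval (p t : CP n).rep f = 0) →
      ∀ x ∈ X, MvPolynomial.eval (Projectivization.rep x) f = 0

/-- No hyperplane contains `X`. -/
def IsNondegenerate {n : ℕ} (X : Set (CP n)) : Prop :=
  ∀ c : Fin (n + 1) → ℂ, (∀ x ∈ X, ∑ i, c i * Projectivization.rep x i = 0) → c = 0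

/-! ### Linear forms -/

/-- The linear form with coefficients `c`. -/
def linForm {σ : Type*} [Fintype σ] (c : σ → ℂ) : MvPolynomial σ ℂ :=
  ∑ i, MvPolynomial.C (c i) * MvPolynomial.X i

theorem linForm_isHomogeneous {σ : Type*} [Fintype σ] (c : σ → ℂ) :
    (linForm c).IsHomogeneous 1 :=
  MvPolynomial.IsHomogeneous.sum _ _ _ fun i _ => (MvPolynomial.isHomogeneous_X ℂ i).C_mul _

theorem eval_linForm {σ : Type*} [Fintype σ] (c v : σ → ℂ) :
    MvPolynomial.eval v (linForm c) = ∑ i, c i * v i := by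
  simp [linForm]

theorem exists_coord_eq_sum {I J : Type*} [Fintype I] (T : (I → ℂ) →ₗ[ℂ] (J → ℂ)) (j : J) :
    ∃ c : I → ℂ, ∀ y, T y j = ∑ i, c i * y i := by
  classical
  refine ⟨fun i => T (Pi.single i 1) j, fun y => ?_⟩
  conv_lhs => rw [pi_eq_sum_univ' y]
  simp [mul_comm]

/-! ### Toric models -/

/-- The map `emb : Z → ℙ(ℂ^I)` is injective, its image is cut out by binomial quadrics, and it is
the closure of the torus orbit with exponents `f`. -/
structure IsToricModel {I Z : Type*} (emb : Z → CoordP I) (f : I → Fin 2 → ℤ)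
    (R : Set (I × I × I × I)) : Prop where
  injective : Function.Injective emb
  mem_range : ∀ (y : I → ℂ) (hy : y ≠ 0), Projectivization.mk ℂ y hy ∈ Set.range emb ↔
    ∀ r ∈ R, y r.1 * y r.2.1 = y r.2.2.1 * y r.2.2.2
  torus : ∀ t, ∀ r ∈ R, torusVec f t r.1 * torusVec f t r.2.1 =
    torusVec f t r.2.2.1 * torusVec f t r.2.2.2
  dense : ∀ (y : I → ℂ) (hy : y ≠ 0), Projectivization.mk ℂ y hy ∈ Set.range emb →
    y ∈ closure {y' | ∃ (c : ℂ) (t : Torus), c ≠ 0 ∧ y' = c • torusVec f t}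

section Model

variable {I Z : Type*} [Fintype I] [Nonempty I] {emb : Z → CoordP I} {f : I → Fin 2 → ℤ}
  {R : Set (I × I × I × I)} {n : ℕ} {X : Set (CP n)}

/-- The defining quadrics composed with `T` are closed conditions on the affine cone. They hold on
the multiples of torus vectors, which accumulate at every point of the cone. -/
theorem IsToricModel.projMap_mem_range (hM : IsToricModel emb f R)
    (T : (I → ℂ) ≃ₗ[ℂ] (I → ℂ))
    (hT : ∀ t, projMap T (torusPoint f t) ∈ Set.range emb) (z : Z) :
    projMap T (emb z) ∈ Set.range emb := by
  obtain ⟨y, hy, hyz⟩ : ∃ y hy, Projectivization.mk ℂ y hy = emb z :=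
    ⟨_, _, Projectivization.mk_rep (emb z)⟩
  have hcl := hM.dense y hy (hyz ▸ ⟨z, rfl⟩)
  rw [← hyz, projMap_mk, hM.mem_range]
  have hTc : Continuous T := LinearMap.continuous_of_finiteDimensional T.toLinearMap
  have hTi : ∀ i, Continuous fun y => T y i := fun i => (continuous_apply i).comp hTc
  intro r hr
  have hclosed : IsClosed {y : I → ℂ | T y r.1 * T y r.2.1 = T y r.2.2.1 * T y r.2.2.2} :=
    isClosed_eq ((hTi _).mul (hTi _)) ((hTi _).mul (hTi _))
  refine closure_minimal ?_ hclosed hcl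
  rintro _ ⟨c, t, -, rfl⟩
  have h := hT t
  rw [torusPoint, projMap_mk, hM.mem_range] at h
  simp only [Set.mem_ofPred_eq, map_smul, Pi.smul_apply, smul_eq_mul]
  linear_combination c ^ 2 * h r hr

/-- The linear images of the model under `G` and under `H` (which is `X`) coincide. One inclusion
holds because `H⁻¹ ∘ G` sends the orbit into the model, hence the whole model into itself. For the
other, the quadrics pulled back along `G⁻¹` vanish on the image of `p`, hence on `X` by Zariski
density. -/
theorem IsToricModel.exists_parametrization (hM : IsToricModel emb f R) (φ : Z ≃ X)
    (H : (I → ℂ) ≃ₗ[ℂ] (Fin (n + 1) → ℂ)) (hφ : ∀ z, (φ z : CP n) = projMap H (emb z))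
    (G : (I → ℂ) ≃ₗ[ℂ] (Fin (n + 1) → ℂ)) (p : Torus → X)
    (hp : ∀ t, (p t : CP n) = projMap G (torusPoint f t)) (hd : HasDenseImage p) :
    ∃ ψ : Z ≃ X, ∀ z, (ψ z : CP n) = projMap G (emb z) := by
  have hmem : ∀ x : CP n, x ∈ X ↔ projMap H.symm x ∈ Set.range emb := by
    intro x
    constructor
    · intro hx
      obtain ⟨z, hz⟩ := φ.surjective ⟨x, hx⟩
      refine ⟨z, ?_⟩
      have : x = projMap H (emb z) := by rw [← hφ, hz]
      rw [this, projMap_symm_projMap]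
    · rintro ⟨z, hz⟩
      have : x = φ z := by rw [hφ, hz, projMap_projMap_symm]
      rw [this]
      exact (φ z).2
  have hin : ∀ z, projMap G (emb z) ∈ X := by
    intro z
    rw [hmem, ← projMap_trans]
    refine hM.projMap_mem_range _ (fun t => ?_) z
    rw [projMap_trans, ← hp, ← hmem]
    exact (p t).2
  have hout : ∀ x ∈ X, projMap G.symm x ∈ Set.range emb := by
    intro x hx
    have key : ∀ x : CP n, projMap G.symm x ∈ Set.range emb ↔
        ∀ r ∈ R, G.symm x.rep r.1 * G.symm x.rep r.2.1 =
          G.symm x.rep r.2.2.1 * G.symm x.rep r.2.2.2 := by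
      intro x
      conv_lhs => rw [← Projectivization.mk_rep x, projMap_mk]
      rw [hM.mem_range]
    rw [key]
    intro r hr
    -- The coordinates of `G⁻¹` as linear forms turn each binomial relation into a homogeneous
    -- polynomial of degree 2, to which `hd` applies.
    choose c hc using exists_coord_eq_sum G.symm.toLinearMap
    have := hd 2 (linForm (c r.1) * linForm (c r.2.1) -
        linForm (c r.2.2.1) * linForm (c r.2.2.2))
      (((linForm_isHomogeneous _).mul (linForm_isHomogeneous _)).sub
        ((linForm_isHomogeneous _).mul (linForm_isHomogeneous _))) ?_ x hx
    · simpa [eval_linForm, ← hc, sub_eq_zero] using this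
    · intro t
      have h : projMap G.symm (p t : CP n) ∈ Set.range emb := by
        rw [hp, projMap_symm_projMap, torusPoint, hM.mem_range]
        exact hM.torus t
      rw [key] at h
      simpa [eval_linForm, ← hc, sub_eq_zero] using h r hr
  refine ⟨Equiv.ofBijective (fun z => ⟨projMap G (emb z), hin z⟩) ⟨fun z z' h => ?_, ?_⟩,
    fun z => rfl⟩
  · exact hM.injective (projMap_injective G (congrArg Subtype.val h))
  · rintro ⟨x, hx⟩
    obtain ⟨z, hz⟩ := hout x hx
    refine ⟨z, Subtype.ext ?_⟩
    change projMap G (emb z) = x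
    rw [hz, projMap_projMap_symm]

/-- Both sides are locally given by continuous functions of homogeneous coordinates and agree on the
torus orbit, which is dense in the classical topology. -/
theorem IsToricModel.antiholomorphic_eq (hM : IsToricModel emb f R) {σ : X → X}
    (hσ : IsAntiholomorphic σ) (G : (I → ℂ) ≃ₗ[ℂ] (Fin (n + 1) → ℂ)) (p : Torus → X)
    (hp : ∀ t, (p t : CP n) = projMap G (torusPoint f t)) (π : Equiv.Perm I)
    (hσp : ∀ t, (σ (p t) : CP n) = projMap G (projConjPerm π (torusPoint f t)))
    (ψ : Z ≃ X) (hψ : ∀ z, (ψ z : CP n) = projMap G (emb z)) (z : Z) :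
    (σ (ψ z) : CP n) = projMap G (projConjPerm π (emb z)) := by
  obtain ⟨y, hy, hyz⟩ : ∃ y hy, Projectivization.mk ℂ y hy = emb z :=
    ⟨_, _, Projectivization.mk_rep (emb z)⟩
  have hcl := hM.dense y hy (hyz ▸ ⟨z, rfl⟩)
  have hGy : G y ≠ 0 := (map_ne_zero_iff G G.injective).mpr hy
  have hψz : (ψ z : CP n) = Projectivization.mk ℂ (G y) hGy := by
    rw [hψ, ← hyz, projMap_mk]
  have hX : Projectivization.mk ℂ (G y) hGy ∈ X := hψz ▸ (ψ z).2
  obtain ⟨U, F, hU, hvU, hF, hσF⟩ := hσ (G y) hGy hX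
  have hGc : Continuous G := LinearMap.continuous_of_finiteDimensional G.toLinearMap
  have hFy : ContinuousAt (fun y' => F (G y')) y :=
    ContinuousAt.comp (f := fun y' => G y') ((hF.continuousOn).continuousAt (hU.mem_nhds hvU))
      hGc.continuousAt
  have hLc : Continuous fun y' => G (conjPerm π y') := by
    refine hGc.comp (continuous_pi fun i => ?_)
    exact Complex.continuous_conj.comp (continuous_apply _)
  obtain ⟨h1, h2⟩ := hσF (G y) hGy hX hvU
  have hz : ψ z = ⟨Projectivization.mk ℂ (G y) hGy, hX⟩ := Subtype.ext hψz
  rw [hz, h2, ← hyz, projConjPerm_mk, projMap_mk]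
  -- Each minor of the two coordinate vectors vanishes at orbit points near `y`; both of its terms
  -- are continuous, so it vanishes in the limit.
  refine mk_eq_mk_of_mul_eq _ _ fun i j => ?_
  set S := {y' : I → ℂ | ∃ (c : ℂ) (t : Torus), c ≠ 0 ∧ y' = c • torusVec f t} with hS
  have hne : (𝓝[S] y).NeBot := mem_closure_iff_nhdsWithin_neBot.mp hcl
  have hFi : ∀ i, Tendsto (fun y' => starRingEnd ℂ (F (G y') i)) (𝓝[S] y)
      (𝓝 (starRingEnd ℂ (F (G y) i))) := fun i =>
    (Complex.continuous_conj.continuousAt.comp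
      ((continuous_apply i).continuousAt.comp hFy)).tendsto.mono_left nhdsWithin_le_nhds
  have hLi : ∀ i, Tendsto (fun y' => G (conjPerm π y') i) (𝓝[S] y)
      (𝓝 (G (conjPerm π y) i)) := fun i =>
    ((continuous_apply i).comp hLc).continuousAt.tendsto.mono_left nhdsWithin_le_nhds
  refine tendsto_nhds_unique_of_eventuallyEq ((hFi i).mul (hLi j)) ((hFi j).mul (hLi i)) ?_
  have hev : ∀ᶠ y' in 𝓝[S] y, G y' ∈ U :=
    nhdsWithin_le_nhds (hGc.continuousAt.eventually (hU.mem_nhds hvU))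
  filter_upwards [hev, self_mem_nhdsWithin] with y' hy'U hy'S
  obtain ⟨c, t, hc, rfl⟩ := hy'S
  have hct : c • torusVec f t ≠ 0 := smul_ne_zero hc (torusVec_ne_zero f t)
  have hpt : torusPoint f t = Projectivization.mk ℂ (c • torusVec f t) hct := by
    rw [torusPoint, eq_comm, Projectivization.mk_eq_mk_iff']
    exact ⟨c, rfl⟩
  have hpm : (p t : CP n) = Projectivization.mk ℂ (G (c • torusVec f t))
      ((map_ne_zero_iff G G.injective).mpr hct) := by rw [hp, hpt, projMap_mk]
  obtain ⟨h3, h4⟩ := hσF _ ((map_ne_zero_iff G G.injective).mpr hct) (hpm ▸ (p t).2) hy'U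
  have h5 : p t = ⟨_, hpm ▸ (p t).2⟩ := Subtype.ext hpm
  rw [← h5, hσp, hpt, projConjPerm_mk, projMap_mk, Projectivization.mk_eq_mk_iff'] at h4
  obtain ⟨a, ha⟩ := h4
  have hai := congrFun ha i
  have haj := congrFun ha j
  simp only [Pi.smul_apply, smul_eq_mul] at hai haj
  rw [← hai, ← haj]
  ring

end Model

/-! ### Normal form of toric parametrizations -/

section Normalize

variable {n : ℕ} {X : Set (CP n)}

/-- If two exponents agreed, two coordinates of `g⁻¹ (p t)` would be equal for all `t`. That linear
relation would hold on `X` by density, so `X` would lie in a hyperplane. -/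
theorem IsToricParametrization.exponents_injective {e : Fin (n + 1) → Fin 2 → ℤ}
    {g : GL (Fin (n + 1)) ℂ} {p : Torus → X} (hp : IsToricParametrization e g p)
    (hX : IsNondegenerate X) : Function.Injective e := by
  intro i j hij
  by_contra hne
  set g' : Matrix (Fin (n + 1)) (Fin (n + 1)) ℂ := (g⁻¹ : GL (Fin (n + 1)) ℂ).val with hg'
  have hgg : g' * (g : Matrix (Fin (n + 1)) (Fin (n + 1)) ℂ) = 1 := by
    rw [hg', ← Units.val_mul]; simp
  have hgg' : (g : Matrix (Fin (n + 1)) (Fin (n + 1)) ℂ) * g' = 1 := by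
    rw [hg', ← Units.val_mul]; simp
  -- The linear form is the difference of rows `i` and `j` of `g⁻¹`. Nondegeneracy makes these rows
  -- equal, which is absurd for an invertible matrix.
  have hc : (fun k => g' i k - g' j k) = 0 := by
    refine hX _ fun x hx => ?_
    have := hp.dense 1 (linForm fun k => g' i k - g' j k) (linForm_isHomogeneous _) ?_ x hx
    · rwa [eval_linForm] at this
    · intro t
      obtain ⟨h, ht⟩ := hp.monomial t
      obtain ⟨a, ha⟩ := Projectivization.exists_smul_eq_mk_rep ℂ _ h
      rw [eval_linForm, ht, ← ha]
      have hmv := congrArg (fun B => Matrix.mulVec B (fun i => character (e i) t)) hgg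
      simp only [← Matrix.mulVec_mulVec, Matrix.one_mulVec] at hmv
      have hi := congrFun hmv i
      have hj := congrFun hmv j
      rw [← hij, ← hi] at hj
      simp only [Matrix.mulVec, dotProduct] at hj
      have h0 : ∀ w : Fin (n + 1) → ℂ, ∑ k, g' j k * w k = ∑ k, g' i k * w k →
          ∑ k, (g' i k - g' j k) * (a • w) k = 0 := by
        intro w hw
        have : ∀ k, (g' i k - g' j k) * (a • w) k = (a : ℂ) * (g' i k * w k - g' j k * w k) := by
          intro k
          rw [Pi.smul_apply, Units.smul_def, smul_eq_mul]; ring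
        simp only [this, ← Finset.mul_sum, Finset.sum_sub_distrib, hw, sub_self, mul_zero]
      exact h0 _ hj
  have h1 : (g' * (g : Matrix (Fin (n + 1)) (Fin (n + 1)) ℂ)) i i =
      (g' * (g : Matrix (Fin (n + 1)) (Fin (n + 1)) ℂ)) j i := by
    rw [Matrix.mul_apply, Matrix.mul_apply]
    exact Finset.sum_congr rfl fun k _ => by rw [sub_eq_zero.mp (congrFun hc k)]
  rw [hgg, Matrix.one_apply_eq, Matrix.one_apply_ne (Ne.symm hne)] at h1
  exact one_ne_zero h1

/-- The map `x ↦ Ax + c` sends the `n + 1` distinct exponents to lattice points of `Q`, all of which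
are values of `f`. Choosing labels gives an injection into `I`, a bijection by counting.
Precomposing `p` with the torus automorphism of `A` replaces `e i` by `f (ε i) - c`, and the shift
is a common scalar factor. The relation `AN = MA` then makes `σ` act through `M` on the exponents,
hence through `π` on the coordinates. -/
theorem ActsAs.exists_normal_form {I : Type*} [Fintype I] [Nonempty I] {σ : X → X}
    {Q : Set (Fin 2 → ℝ)} {M : Matrix (Fin 2) (Fin 2) ℤ} (h : ActsAs σ Q M)
    (hX : IsNondegenerate X) (f : I → Fin 2 → ℤ) (hcard : Fintype.card I = n + 1)
    (hQ : ∀ v : Fin 2 → ℤ, (fun j => (v j : ℝ)) ∈ Q → ∃ i, f i = v)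
    (π : Equiv.Perm I) (hπ : ∀ i, f (π i) = M.mulVec (f i)) :
    ∃ (G : (I → ℂ) ≃ₗ[ℂ] (Fin (n + 1) → ℂ)) (p : Torus → X),
      (∀ t, (p t : CP n) = projMap G (torusPoint f t)) ∧ HasDenseImage p ∧
        ∀ t, (σ (p t) : CP n) = projMap G (projConjPerm π (torusPoint f t)) := by
  obtain ⟨e, g, p, τ, N, hp, hσ, hτ, A, c, hAQ, hAN⟩ := h
  have he := hp.exponents_injective hX
  have hpt : ∀ i, ∃ k, f k = (A : Matrix (Fin 2) (Fin 2) ℤ).mulVec (e i) + c := by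
    intro i
    refine hQ _ ?_
    rw [← hAQ]
    refine ⟨fun j => (e i j : ℝ), subset_convexHull ℝ _ ⟨i, rfl⟩, ?_⟩
    funext j
    fin_cases j <;> simp
  choose ε hε using hpt
  have hAinj : Function.Injective (A : Matrix (Fin 2) (Fin 2) ℤ).mulVec :=
    Matrix.mulVec_injective_of_isUnit A.isUnit
  have hεinj : Function.Injective ε := by
    intro i j hij
    have h1 := hε i
    rw [hij, hε j] at h1
    exact (he (hAinj (add_right_cancel h1))).symm
  have hεbij : Function.Bijective ε :=
    (Fintype.bijective_iff_injective_and_card ε).mpr ⟨hεinj, by simp [hcard]⟩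
  let E : Fin (n + 1) ≃ I := Equiv.ofBijective ε hεbij
  have hGa : ∀ y, reindexMulVec E g y =
      (g : Matrix (Fin (n + 1)) (Fin (n + 1)) ℂ).mulVec fun i => y (ε i) := fun _ => rfl
  have hmono : ∀ i s, character (e i) (torusHom A s) =
      (character c s)⁻¹ * torusVec f s (ε i) := by
    intro i s
    rw [character_torusHom, torusVec, hε, character_add]
    field_simp [character_ne_zero c s]
  refine ⟨reindexMulVec E g, fun s => p (torusHom A s), fun s => ?_, fun d F hF hF0 => ?_, fun s => ?_⟩
  · obtain ⟨h1, h2⟩ := hp.monomial (torusHom A s)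
    rw [h2, torusPoint, projMap_mk, Projectivization.mk_eq_mk_iff']
    refine ⟨(character c s)⁻¹, ?_⟩
    rw [← map_smul, hGa]
    simp only [hmono, Pi.smul_apply, smul_eq_mul]
  · refine hp.dense d F hF fun t => ?_
    obtain ⟨s, rfl⟩ := torusHom_surjective A t
    exact hF0 s
  · obtain ⟨h1, h2⟩ := hp.monomial (τ (torusHom A s))
    rw [hσ, h2, torusPoint, projConjPerm_mk, projMap_mk, Projectivization.mk_eq_mk_iff']
    -- Since `M (A e) = M (f (ε i)) - M c`, the common factor is now the conjugate of the inverse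
    -- character of `M c`.
    refine ⟨starRingEnd ℂ (character (M.mulVec c) s)⁻¹, ?_⟩
    rw [← map_smul, hGa]
    congr 1
    funext i
    rw [hτ, character_torusHom, Matrix.mulVec_mulVec, hAN, Pi.smul_apply, conjPerm_apply,
      smul_eq_mul, ← map_mul, torusVec, hπ, hε, Matrix.mulVec_add, character_add,
      Matrix.mulVec_mulVec]
    congr 1
    rw [mul_comm, mul_inv_cancel_right₀ (character_ne_zero _ s)]

/-- If `σ` acts as `M` on the polygon with lattice points `f`, then it is equivalent to the real
structure `c` of `Z`, by means of a parametrization of `X` that is projectively equivalent to the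
standard one. Here `B` is an automorphism of `Z`, given by `S` in coordinates, that moves `c` to
the antiholomorphic map that permutes the coordinates according to `M`. -/
theorem ActsAs.exists_equivariant_parametrization {I Z : Type*} [Fintype I] [Nonempty I]
    {emb : Z → CoordP I} {f : I → Fin 2 → ℤ} {R : Set (I × I × I × I)}
    (hM : IsToricModel emb f R) {σ : X → X} (hσ : IsAntiholomorphic σ)
    {Q : Set (Fin 2 → ℝ)} {M : Matrix (Fin 2) (Fin 2) ℤ} (h : ActsAs σ Q M)
    (hX : IsNondegenerate X) (hcard : Fintype.card I = n + 1)
    (hQ : ∀ v : Fin 2 → ℤ, (fun j => (v j : ℝ)) ∈ Q → ∃ i, f i = v)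
    (φ : Z ≃ X) (H : (I → ℂ) ≃ₗ[ℂ] (Fin (n + 1) → ℂ)) (hφ : ∀ z, (φ z : CP n) = projMap H (emb z))
    (π : Equiv.Perm I) (hπ : ∀ i, f (π i) = M.mulVec (f i))
    (S : (I → ℂ) ≃ₗ[ℂ] (I → ℂ)) (B : Equiv.Perm Z) (hB : ∀ z, emb (B z) = projMap S (emb z))
    (c : Z → Z) (hc : ∀ z, projConjPerm π (emb (B z)) = emb (B (c z))) :
    ∃ (ψ : Z ≃ X) (K : (I → ℂ) ≃ₗ[ℂ] (Fin (n + 1) → ℂ)),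
      (∀ z, (ψ z : CP n) = projMap K (emb z)) ∧ ∀ z, σ (ψ z) = ψ (c z) := by
  obtain ⟨G, p, hp, hd, hσp⟩ := h.exists_normal_form hX f hcard hQ π hπ
  obtain ⟨ψ, hψ⟩ := hM.exists_parametrization φ H hφ G p hp hd
  refine ⟨B.trans ψ, S.trans G, fun z => ?_, fun z => Subtype.ext ?_⟩
  · rw [projMap_trans, ← hB, ← hψ]; rfl
  · rw [Equiv.trans_apply, hM.antiholomorphic_eq hσ G p hp π hσp ψ hψ, hc, ← hψ]; rfl

/-- Take `γ = ψ ∘ ψ'⁻¹`. Then `γ⁻¹ σ γ = ψ' c ψ'⁻¹ = σ'`. Transported to `Z` by `φ`, it is linear in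
the coordinates of `emb`, so `hA` applies. -/
theorem innerAutomorphicVia_of_equivariant {I Z : Type*} {emb : Z → CoordP I} {φ : Z ≃ X}
    {H : (I → ℂ) ≃ₗ[ℂ] (Fin (n + 1) → ℂ)} (hφ : ∀ z, (φ z : CP n) = projMap H (emb z))
    {A : Set (Equiv.Perm Z)}
    (hA : ∀ (α : Equiv.Perm Z) (T : (I → ℂ) ≃ₗ[ℂ] (I → ℂ)),
      (∀ z, emb (α z) = projMap T (emb z)) → α ∈ A)
    {c : Z → Z} {σ σ' : X → X} {ψ ψ' : Z ≃ X} {K K' : (I → ℂ) ≃ₗ[ℂ] (Fin (n + 1) → ℂ)}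
    (hψ : ∀ z, (ψ z : CP n) = projMap K (emb z)) (hσ : ∀ z, σ (ψ z) = ψ (c z))
    (hψ' : ∀ z, (ψ' z : CP n) = projMap K' (emb z)) (hσ' : ∀ z, σ' (ψ' z) = ψ' (c z)) :
    InnerAutomorphicVia φ A σ σ' := by
  have hinv : ∀ x : X, emb (ψ'.symm x) = projMap K'.symm (x : CP n) := by
    intro x
    obtain ⟨z, rfl⟩ := ψ'.surjective x
    rw [Equiv.symm_apply_apply, hψ', projMap_symm_projMap]
  have hφinv : ∀ x : X, emb (φ.symm x) = projMap H.symm (x : CP n) := by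
    intro x
    obtain ⟨z, rfl⟩ := φ.surjective x
    rw [Equiv.symm_apply_apply, hφ, projMap_symm_projMap]
  refine ⟨((φ.trans ψ'.symm).trans ψ).trans φ.symm,
    hA _ (((H.trans K'.symm).trans K).trans H.symm) fun z => ?_, ?_⟩
  · simp only [Equiv.trans_apply, projMap_trans]
    rw [hφinv, hψ, hinv, hφ]
  · funext x
    obtain ⟨z, rfl⟩ := ψ'.surjective x
    simp [Equiv.permCongr_def, hσ, hσ']

end Normalize

/-! ### Polynomials with prescribed monomials -/

section Monomials

variable {σ I : Type*} [Fintype I]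

/-- The form with coefficient `c i` at the monomial `mono i`. -/
def formOf (mono : I → σ →₀ ℕ) (c : I → ℂ) : MvPolynomial σ ℂ :=
  ∑ i, MvPolynomial.monomial (mono i) (c i)

theorem eval_formOf (mono : I → σ →₀ ℕ) (c : I → ℂ) (x : σ → ℂ) :
    MvPolynomial.eval x (formOf mono c) =
      ∑ i, c i * MvPolynomial.eval x (MvPolynomial.monomial (mono i) 1) := by
  simp [formOf, MvPolynomial.eval_monomial]

theorem formOf_isWeightedHomogeneous {M : Type*} [AddCommMonoid M] {w : σ → M} {d : M}
    {mono : I → σ →₀ ℕ} (hmono : ∀ i, Finsupp.weight w (mono i) = d) (c : I → ℂ) :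
    (formOf mono c).IsWeightedHomogeneous w d :=
  MvPolynomial.IsWeightedHomogeneous.sum _ _ _ fun i _ =>
    MvPolynomial.isWeightedHomogeneous_monomial _ _ _ (hmono i)

theorem eq_formOf {mono : I → σ →₀ ℕ} (hinj : Function.Injective mono) (P : MvPolynomial σ ℂ)
    (hP : ∀ d, P.coeff d ≠ 0 → d ∈ Set.range mono) :
    P = formOf mono fun i => P.coeff (mono i) := by
  classical
  ext d
  rw [formOf, MvPolynomial.coeff_sum]
  simp only [MvPolynomial.coeff_monomial]
  by_cases hd : d ∈ Set.range mono
  · obtain ⟨j, rfl⟩ := hd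
    simp [hinj.eq_iff]
  · rw [Finset.sum_eq_zero]
    · by_contra h
      exact hd (hP d h)
    · intro i _
      rw [if_neg fun h => hd ⟨i, h⟩]

/-- The coefficient matrix is square, and linear independence of the forms is independence of its
rows, so it is invertible. -/
theorem exists_linearEquiv_eval {m : ℕ} {mono : I → σ →₀ ℕ} (hinj : Function.Injective mono)
    (hcard : Fintype.card I = m) (F : Fin m → MvPolynomial σ ℂ) (hF : LinearIndependent ℂ F)
    (hsupp : ∀ i d, (F i).coeff d ≠ 0 → d ∈ Set.range mono) :
    ∃ H : (I → ℂ) ≃ₗ[ℂ] (Fin m → ℂ), ∀ x : σ → ℂ,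
      (fun i => MvPolynomial.eval x (F i)) =
        H fun j => MvPolynomial.eval x (MvPolynomial.monomial (mono j) 1) := by
  obtain ⟨E⟩ : Nonempty (Fin m ≃ I) := ⟨(Fintype.equivFinOfCardEq hcard).symm⟩
  have hFi := fun i => eq_formOf hinj (F i) (hsupp i)
  set A : Matrix (Fin m) (Fin m) ℂ := Matrix.of fun i j => (F i).coeff (mono (E j)) with hA
  have hAinj : Function.Injective fun c => Matrix.vecMul c A := by
    intro c c' h
    rw [Fintype.linearIndependent_iff] at hF
    have h0 : ∑ i, (c i - c' i) • F i = 0 := by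
      ext d
      simp only [MvPolynomial.coeff_sum, MvPolynomial.coeff_smul, MvPolynomial.coeff_zero]
      by_cases hd : d ∈ Set.range mono
      · obtain ⟨j, rfl⟩ := hd
        have := congrFun h (E.symm j)
        simp only [Matrix.vecMul, dotProduct, hA, Matrix.of_apply, Equiv.apply_symm_apply] at this
        simp only [smul_eq_mul, sub_mul, Finset.sum_sub_distrib, this, sub_self]
      · refine Finset.sum_eq_zero fun i _ => ?_
        have : (F i).coeff d = 0 := by
          by_contra h
          exact hd (hsupp i d h)
        rw [this, smul_zero]
    funext i
    exact sub_eq_zero.mp (hF _ h0 i)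
  obtain ⟨g, hg⟩ := Matrix.vecMul_injective_iff_isUnit.mp hAinj
  refine ⟨reindexMulVec E g, fun x => funext fun i => ?_⟩
  rw [reindexMulVec_apply, hg, hFi, eval_formOf, ← E.sum_comp]
  rfl

/-- A linear relation on `X` makes a combination of the `F i` vanish at every point of affine space,
trivially so at common zeros. A polynomial over `ℂ` vanishing everywhere is zero. -/
theorem isNondegenerate_of_linearIndependent {n : ℕ} {X : Set (CP n)}
    (F : Fin (n + 1) → MvPolynomial σ ℂ) (hF : LinearIndependent ℂ F)
    (hX : ∀ x : σ → ℂ, (fun i => MvPolynomial.eval x (F i)) = 0 ∨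
      ∃ h : (fun i => MvPolynomial.eval x (F i)) ≠ 0, Projectivization.mk ℂ _ h ∈ X) :
    IsNondegenerate X := by
  intro c hc
  rw [Fintype.linearIndependent_iff] at hF
  refine funext (hF c (MvPolynomial.funext fun x => ?_))
  simp only [map_sum, MvPolynomial.smul_eval, map_zero]
  rcases hX x with h0 | ⟨h, hx⟩
  · exact Finset.sum_eq_zero fun i _ => by
      rw [show MvPolynomial.eval x (F i) = 0 from congrFun h0 i, mul_zero]
  · have h1 := hc _ hx
    obtain ⟨a, ha⟩ := Projectivization.exists_smul_eq_mk_rep ℂ _ h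
    rw [← ha] at h1
    have h2 : (a : ℂ) * ∑ i, c i * MvPolynomial.eval x (F i) = 0 := by
      rw [Finset.mul_sum, ← h1]
      refine Finset.sum_congr rfl fun i _ => ?_
      rw [Pi.smul_apply, Units.smul_def, smul_eq_mul]
      ring
    exact (mul_eq_zero.mp h2).resolve_left a.ne_zero

end Monomials

/-! ### Quadratic monomials -/

section Quadratic

variable {σ : Type*}

/-- The vector of the products `v a * v b`. -/
def veroneseVec (v : σ → ℂ) : Sym2 σ → ℂ := fun q => (q.map v).mul

@[simp]
theorem veroneseVec_mk (v : σ → ℂ) (a b : σ) : veroneseVec v s(a, b) = v a * v b := rfl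

theorem veroneseVec_ne_zero {v : σ → ℂ} (hv : v ≠ 0) : veroneseVec v ≠ 0 := by
  obtain ⟨a, ha⟩ := Function.ne_iff.mp hv
  exact Function.ne_iff.mpr ⟨s(a, a), mul_ne_zero ha ha⟩

theorem veroneseVec_smul (c : ℂ) (v : σ → ℂ) : veroneseVec (c • v) = c ^ 2 • veroneseVec v := by
  funext q
  induction q using Sym2.ind with | _ a b => simp; ring

theorem continuous_veroneseVec : Continuous (veroneseVec : (σ → ℂ) → Sym2 σ → ℂ) := by
  refine continuous_pi fun q => ?_
  induction q using Sym2.ind with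
  | _ a b => exact (continuous_apply a).mul (continuous_apply b)

theorem mk_eq_mk_of_veroneseVec {v w : σ → ℂ} (hv : v ≠ 0) (hw : w ≠ 0) {a : ℂ}
    (h : a • veroneseVec w = veroneseVec v) :
    Projectivization.mk ℂ v hv = Projectivization.mk ℂ w hw := by
  obtain ⟨k, hk⟩ := Function.ne_iff.mp hv
  refine mk_eq_mk_of_mul_eq hv hw fun i j => mul_right_cancel₀ (b := v k) hk ?_
  have hi := congrFun h s(i, k)
  have hj := congrFun h s(j, k)
  simp only [Pi.smul_apply, veroneseVec_mk, smul_eq_mul] at hi hj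
  linear_combination w i * hj - w j * hi

/-- The permutation of unordered pairs induced by a permutation. -/
def symPerm (s : Equiv.Perm σ) : Equiv.Perm (Sym2 σ) where
  toFun := Sym2.map s
  invFun := Sym2.map s.symm
  left_inv q := by simp [Sym2.map_map]
  right_inv q := by simp [Sym2.map_map]

theorem conj_veroneseVec_symPerm (s : Equiv.Perm σ) (v : σ → ℂ) (q : Sym2 σ) :
    starRingEnd ℂ (veroneseVec v (symPerm s q)) =
      veroneseVec (fun i => starRingEnd ℂ (v (s i))) q := by
  induction q using Sym2.ind with | _ a b => simp [symPerm]

/-- The exponent of the quadratic monomial given by an unordered pair. -/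
def symExp (q : Sym2 σ) : σ →₀ ℕ := (q.map fun a => Finsupp.single a 1).add

theorem symExp_mk (a b : σ) : symExp s(a, b) = Finsupp.single a 1 + Finsupp.single b 1 := rfl

theorem toMultiset_symExp (a b : σ) : Finsupp.toMultiset (symExp s(a, b)) = {a, b} := by
  rw [symExp_mk, map_add, Finsupp.toMultiset_single, Finsupp.toMultiset_single]
  simp

theorem symExp_injective : Function.Injective (symExp : Sym2 σ → σ →₀ ℕ) := by
  intro q r
  induction q using Sym2.ind with
  | _ a b =>
    induction r using Sym2.ind with
    | _ c d =>
      intro h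
      have h1 := congrArg Finsupp.toMultiset h
      rw [toMultiset_symExp, toMultiset_symExp] at h1
      rw [Sym2.eq_iff]
      classical
      rw [Multiset.insert_eq_cons, Multiset.insert_eq_cons, Multiset.cons_eq_cons] at h1
      rcases h1 with ⟨h1, h2⟩ | ⟨h1, cs, h2, h3⟩
      · exact Or.inl ⟨h1, Multiset.singleton_inj.mp h2⟩
      · rw [Multiset.singleton_eq_cons_iff] at h2 h3
        exact Or.inr ⟨h3.1.symm, h2.1⟩

theorem degree_symExp (q : Sym2 σ) : (symExp q).degree = 2 := by
  induction q using Sym2.ind with | _ a b => simp [symExp_mk]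

theorem mem_range_symExp {d : σ →₀ ℕ} (hd : d.degree = 2) : d ∈ Set.range symExp := by
  have h : (Finsupp.toMultiset d).card = 2 := by
    rw [Finsupp.card_toMultiset]; exact hd
  obtain ⟨a, b, hab⟩ := Multiset.card_eq_two.mp h
  classical
  refine ⟨s(a, b), ?_⟩
  rw [← Finsupp.toMultiset_toFinsupp d, hab, ← toMultiset_symExp, Finsupp.toMultiset_toFinsupp]

theorem prod_symExp (v : σ → ℂ) (q : Sym2 σ) :
    ((symExp q).prod fun i k => v i ^ k) = veroneseVec v q := by
  induction q using Sym2.ind with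
  | _ a b =>
    classical
    rw [symExp_mk, Finsupp.prod_add_index (by simp) (fun _ _ _ _ => pow_add _ _ _)]
    simp

theorem eval_monomial_symExp (v : σ → ℂ) (q : Sym2 σ) :
    MvPolynomial.eval v (MvPolynomial.monomial (symExp q) 1) = veroneseVec v q := by
  rw [MvPolynomial.eval_monomial, one_mul, prod_symExp]

/-- A nonzero symmetric matrix of rank one is determined by a row through a nonzero diagonal entry.
If `y_ab ≠ 0`, then `y_aa y_bb = y_ab²` makes `y_aa` nonzero, and `y_aa y_cd = y_ac y_ad` shows that
row `a` works. -/
theorem exists_eq_smul_veroneseVec {y : Sym2 σ → ℂ} (hy : y ≠ 0)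
    (h : ∀ a b c d, y s(a, b) * y s(c, d) = y s(a, c) * y s(b, d)) :
    ∃ (c : ℂ) (v : σ → ℂ), v ≠ 0 ∧ c ≠ 0 ∧ y = c • veroneseVec v := by
  obtain ⟨q, hq⟩ := Function.ne_iff.mp hy
  induction q using Sym2.ind with
  | _ a b =>
    have haa : y s(a, a) ≠ 0 := fun h0 => by
      have := h a a b b
      rw [h0, zero_mul] at this
      exact hq (mul_self_eq_zero.mp this.symm)
    refine ⟨(y s(a, a))⁻¹, fun c => y s(a, c), fun h0 => haa (congrFun h0 a), inv_ne_zero haa, ?_⟩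
    funext r
    induction r using Sym2.ind with
    | _ c d =>
      rw [Pi.smul_apply, veroneseVec_mk, ← h, smul_eq_mul, inv_mul_cancel_left₀ haa]

/-! ### Linear substitutions in quadratic forms -/

variable [Fintype σ]

/-- The action of a matrix on the coordinates `v a * v b`. -/
def symMap (B : Matrix σ σ ℂ) : (Sym2 σ → ℂ) →ₗ[ℂ] (Sym2 σ → ℂ) where
  toFun y p := Sym2.lift ⟨fun a b => ∑ c, ∑ d, B a c * B b d * y s(c, d), fun a b => by
    refine Finset.sum_comm.trans ?_
    exact Finset.sum_congr rfl fun c _ => Finset.sum_congr rfl fun d _ => by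
      rw [Sym2.eq_swap, mul_comm (B a d)]⟩ p
  map_add' y y' := by
    funext p
    induction p using Sym2.ind with
    | _ a b => simp [mul_add, Finset.sum_add_distrib]
  map_smul' r y := by
    funext p
    induction p using Sym2.ind with
    | _ a b =>
      simp only [Sym2.lift_mk, Pi.smul_apply, smul_eq_mul, Finset.mul_sum, RingHom.id_apply]
      exact Finset.sum_congr rfl fun c _ => Finset.sum_congr rfl fun d _ => by ring

theorem symMap_mk (B : Matrix σ σ ℂ) (y : Sym2 σ → ℂ) (a b : σ) :
    symMap B y s(a, b) = ∑ c, ∑ d, B a c * B b d * y s(c, d) := rfl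

theorem symMap_veroneseVec (B : Matrix σ σ ℂ) (v : σ → ℂ) :
    symMap B (veroneseVec v) = veroneseVec (B.mulVec v) := by
  funext p
  induction p using Sym2.ind with
  | _ a b =>
    rw [symMap_mk, veroneseVec_mk]
    simp only [Matrix.mulVec, dotProduct, Finset.sum_mul_sum, veroneseVec_mk]
    exact Finset.sum_congr rfl fun c _ => Finset.sum_congr rfl fun d _ => by ring

/-- Functoriality of the symmetric square, proved on all vectors and not only on Veronese vectors,
because `symEquiv` needs a two-sided inverse. -/
theorem symMap_symMap (B C : Matrix σ σ ℂ) (y : Sym2 σ → ℂ) :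
    symMap B (symMap C y) = symMap (B * C) y := by
  funext p
  induction p using Sym2.ind with
  | _ a b =>
    simp only [symMap_mk, Matrix.mul_apply, Finset.mul_sum, Finset.sum_mul]
    calc ∑ c, ∑ d, ∑ e, ∑ f, B a c * B b d * (C c e * C d f * y s(e, f))
        = ∑ c, ∑ e, ∑ d, ∑ f, B a c * B b d * (C c e * C d f * y s(e, f)) :=
          Finset.sum_congr rfl fun c _ => Finset.sum_comm
      _ = ∑ e, ∑ c, ∑ d, ∑ f, B a c * B b d * (C c e * C d f * y s(e, f)) := Finset.sum_comm
      _ = ∑ e, ∑ c, ∑ f, ∑ d, B a c * B b d * (C c e * C d f * y s(e, f)) :=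
          Finset.sum_congr rfl fun e _ => Finset.sum_congr rfl fun c _ => Finset.sum_comm
      _ = ∑ e, ∑ f, ∑ c, ∑ d, B a c * B b d * (C c e * C d f * y s(e, f)) :=
          Finset.sum_congr rfl fun e _ => Finset.sum_comm
      _ = _ := by
          refine Finset.sum_congr rfl fun e _ => Finset.sum_congr rfl fun f _ =>
            Finset.sum_comm.trans
              (Finset.sum_congr rfl fun d _ => Finset.sum_congr rfl fun c _ => ?_)
          ring

theorem symMap_one [DecidableEq σ] (y : Sym2 σ → ℂ) : symMap 1 y = y := by
  funext p
  induction p using Sym2.ind with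
  | _ a b => simp [symMap_mk, Matrix.one_apply]

variable [DecidableEq σ]

/-- The action of an invertible matrix on the coordinates `v a * v b`. -/
def symEquiv (B : GL σ ℂ) : (Sym2 σ → ℂ) ≃ₗ[ℂ] (Sym2 σ → ℂ) :=
  LinearEquiv.ofLinearMap (symMap B.val) (symMap B⁻¹.val)
    (LinearMap.ext fun y => by
      rw [LinearMap.comp_apply, symMap_symMap, ← Units.val_mul, mul_inv_cancel, Units.val_one,
        symMap_one]; rfl)
    (LinearMap.ext fun y => by
      rw [LinearMap.comp_apply, symMap_symMap, ← Units.val_mul, inv_mul_cancel, Units.val_one,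
        symMap_one]; rfl)

theorem symEquiv_veroneseVec (B : GL σ ℂ) (v : σ → ℂ) :
    symEquiv B (veroneseVec v) = veroneseVec (B.val.mulVec v) :=
  symMap_veroneseVec _ _

/-- Multiplication of vectors by an invertible matrix. -/
def mulVecEquiv (B : GL σ ℂ) : (σ → ℂ) ≃ₗ[ℂ] (σ → ℂ) :=
  Matrix.toLin'OfInv (M := B⁻¹.val) (M' := B.val)
    (by rw [← Units.val_mul]; simp) (by rw [← Units.val_mul]; simp)

/-- The projectivity given by an invertible matrix. -/
def projPerm (B : GL σ ℂ) : Equiv.Perm (CoordP σ) where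
  toFun := projMap (mulVecEquiv B)
  invFun := projMap (mulVecEquiv B).symm
  left_inv := projMap_symm_projMap _
  right_inv := projMap_projMap_symm _

theorem mulVec_ne_zero (B : GL σ ℂ) {v : σ → ℂ} (hv : v ≠ 0) : B.val.mulVec v ≠ 0 :=
  (map_ne_zero_iff (mulVecEquiv B) (mulVecEquiv B).injective).mpr hv

theorem projPerm_mk (B : GL σ ℂ) (v : σ → ℂ) (hv : v ≠ 0) :
    projPerm B (Projectivization.mk ℂ v hv) =
      Projectivization.mk ℂ (B.val.mulVec v) (mulVec_ne_zero B hv) :=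
  projMap_mk _ _ _

end Quadratic

theorem eventually_add_ne_zero (a : ℂ) : ∀ᶠ ε in 𝓝[≠] (0 : ℂ), a + ε ≠ 0 := by
  by_cases ha : a = 0
  · filter_upwards [self_mem_nhdsWithin] with ε hε
    simpa [ha] using hε
  · refine nhdsWithin_le_nhds ?_
    have h : Tendsto (fun ε : ℂ => a + ε) (𝓝 0) (𝓝 (a + 0)) :=
      (continuous_const.add continuous_id).tendsto 0
    rw [add_zero] at h
    exact h.eventually_ne ha

theorem tendsto_add_smul_one {σ : Type*} (v : σ → ℂ) :
    Tendsto (fun ε : ℂ => v + fun _ => ε) (𝓝[≠] 0) (𝓝 v) := by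
  have h : Continuous fun ε : ℂ => v + fun _ => ε := by fun_prop
  have h0 := h.tendsto 0
  rw [show (v + fun _ => (0 : ℂ)) = v from add_zero v] at h0
  exact h0.mono_left nhdsWithin_le_nhds

/-! ### Conjugating real structures -/

theorem conjP_mk {k : ℕ} (v : Fin (k + 1) → ℂ) (hv : v ≠ 0) :
    conjP k (Projectivization.mk ℂ v hv) = Projectivization.mk ℂ (conjVec (k + 1) v)
      ((map_ne_zero_iff _ (conjVec_injective _)).mpr hv) :=
  Projectivization.map_mk _ _ _ _

/-- The matrix `B` conjugates the antilinear map `v ↦ conj ∘ v ∘ s` to the standard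
conjugation. -/
def Straightens {k : ℕ} (s : Equiv.Perm (Fin k)) (B : GL (Fin k) ℂ) : Prop :=
  ∀ v i, starRingEnd ℂ (B.val.mulVec v (s i)) = B.val.mulVec (conjVec k v) i

theorem straightens_one {k : ℕ} : Straightens (1 : Equiv.Perm (Fin k)) 1 := by
  intro v i
  simp [conjVec]

/-- The substitution is `(x, y) ↦ (x + iy, x - iy)`: for real `x`, `y` its values are conjugate
pairs, the vectors fixed by conjugation followed by the swap. -/
theorem exists_straightens_swap_two : ∃ B, Straightens (Equiv.swap (0 : Fin 2) 1) B := by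
  have hdet : IsUnit (!![1, Complex.I; 1, -Complex.I] : Matrix (Fin 2) (Fin 2) ℂ).det := by
    rw [Matrix.det_fin_two_of, isUnit_iff_ne_zero]
    intro h
    have := congrArg Complex.im h
    norm_num at this
  refine ⟨Matrix.GeneralLinearGroup.mk'' _ hdet, fun v i => ?_⟩
  change starRingEnd ℂ (Matrix.mulVec !![1, Complex.I; 1, -Complex.I] v _) =
    Matrix.mulVec !![1, Complex.I; 1, -Complex.I] _ i
  fin_cases i <;>
    simp [Matrix.mulVec, dotProduct, Fin.sum_univ_two, conjVec]

theorem exists_straightens_swap_three : ∃ B, Straightens (Equiv.swap (0 : Fin 3) 1) B := by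
  have hdet : IsUnit (!![1, Complex.I, 0; 1, -Complex.I, 0; 0, 0, 1] :
      Matrix (Fin 3) (Fin 3) ℂ).det := by
    have : (!![1, Complex.I, 0; 1, -Complex.I, 0; 0, 0, 1] :
        Matrix (Fin 3) (Fin 3) ℂ).det = -2 * Complex.I := by
      simp [Matrix.det_fin_three]
      ring
    rw [this, isUnit_iff_ne_zero]
    simp
  refine ⟨Matrix.GeneralLinearGroup.mk'' _ hdet, fun v i => ?_⟩
  change starRingEnd ℂ (Matrix.mulVec !![1, Complex.I, 0; 1, -Complex.I, 0; 0, 0, 1] v _) =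
    Matrix.mulVec !![1, Complex.I, 0; 1, -Complex.I, 0; 0, 0, 1] _ i
  have h2 : Equiv.swap (0 : Fin 3) 1 2 = 2 := by decide
  fin_cases i <;>
    simp [Matrix.mulVec, dotProduct, Fin.sum_univ_three, conjVec, h2]

/-! ### The Veronese surface -/

section Veronese

variable {k : ℕ}

/-- The quadratic Veronese embedding of projective space. -/
def veroneseEmb (x : CP k) : CoordP (Sym2 (Fin (k + 1))) :=
  Projectivization.mk ℂ (veroneseVec x.rep) (veroneseVec_ne_zero x.rep_nonzero)

theorem veroneseEmb_mk (v : Fin (k + 1) → ℂ) (hv : v ≠ 0) :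
    veroneseEmb (Projectivization.mk ℂ v hv) =
      Projectivization.mk ℂ (veroneseVec v) (veroneseVec_ne_zero hv) := by
  obtain ⟨a, ha⟩ := Projectivization.exists_smul_eq_mk_rep ℂ v hv
  rw [veroneseEmb, Projectivization.mk_eq_mk_iff']
  exact ⟨(a : ℂ) ^ 2, by rw [← veroneseVec_smul, ← ha]; rfl⟩

theorem veroneseEmb_injective : Function.Injective (veroneseEmb (k := k)) := by
  intro x y h
  induction x using Projectivization.ind with
  | h v hv =>
    induction y using Projectivization.ind with
    | h w hw =>
      rw [veroneseEmb_mk, veroneseEmb_mk, Projectivization.mk_eq_mk_iff'] at h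
      obtain ⟨a, ha⟩ := h
      exact mk_eq_mk_of_veroneseVec hv hw ha

/-- The index set of the quadrics containing the Veronese variety. -/
def veroneseRel (σ : Type*) : Set (Sym2 σ × Sym2 σ × Sym2 σ × Sym2 σ) :=
  {r | ∃ a b c d, r = (s(a, b), s(c, d), s(a, c), s(b, d))}

theorem mk_mem_range_veroneseEmb (y : Sym2 (Fin (k + 1)) → ℂ) (hy : y ≠ 0) :
    Projectivization.mk ℂ y hy ∈ Set.range veroneseEmb ↔
      ∃ (c : ℂ) (v : Fin (k + 1) → ℂ), v ≠ 0 ∧ c ≠ 0 ∧ y = c • veroneseVec v := by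
  constructor
  · rintro ⟨x, hx⟩
    induction x using Projectivization.ind with
    | h v hv =>
      rw [veroneseEmb_mk, eq_comm, Projectivization.mk_eq_mk_iff'] at hx
      obtain ⟨a, rfl⟩ := hx
      exact ⟨a, v, hv, fun h => hy (by rw [h, zero_smul]), rfl⟩
  · rintro ⟨c, v, hv, hc, rfl⟩
    refine ⟨Projectivization.mk ℂ v hv, ?_⟩
    rw [veroneseEmb_mk, eq_comm, Projectivization.mk_eq_mk_iff']
    exact ⟨c, rfl⟩

/-- If `α` sends `v` to `w`, the entries of `T (veroneseVec v)` are `c w_a w_b`. For fixed `a` with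
`w_a ≠ 0` they are homogeneous coordinates of `w`, given by quadratic forms in `v`. A different `a`
may be needed near different points. -/
theorem isRegularMap_of_veroneseEmb (α : CP k → CP k)
    (T : (Sym2 (Fin (k + 1)) → ℂ) ≃ₗ[ℂ] (Sym2 (Fin (k + 1)) → ℂ))
    (hα : ∀ x, veroneseEmb (α x) = projMap T (veroneseEmb x)) : IsRegularMap α := by
  choose coef hcoef using exists_coord_eq_sum T.toLinearMap
  simp only [LinearEquiv.coe_coe] at hcoef
  have heval : ∀ q v, MvPolynomial.eval v (formOf symExp (coef q)) = T (veroneseVec v) q := by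
    intro q v
    rw [eval_formOf, hcoef]
    simp only [eval_monomial_symExp]
  have hrel : ∀ v (hv : v ≠ 0), ∃ w, ∃ hw : w ≠ 0, ∃ c : ℂ,
      α (Projectivization.mk ℂ v hv) = Projectivization.mk ℂ w hw ∧ c ≠ 0 ∧
        T (veroneseVec v) = c • veroneseVec w := by
    intro v hv
    refine ⟨_, (α (Projectivization.mk ℂ v hv)).rep_nonzero, ?_⟩
    have h := hα (Projectivization.mk ℂ v hv)
    rw [veroneseEmb_mk, projMap_mk, veroneseEmb, eq_comm, Projectivization.mk_eq_mk_iff'] at h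
    obtain ⟨c, hc⟩ := h
    refine ⟨c, (Projectivization.mk_rep _).symm, ?_, hc.symm⟩
    rintro rfl
    rw [zero_smul] at hc
    exact (map_ne_zero_iff T T.injective).mpr (veroneseVec_ne_zero hv) hc.symm
  intro v hv
  obtain ⟨w, hw, c, -, hc, hT⟩ := hrel v hv
  obtain ⟨a, ha⟩ := Function.ne_iff.mp hw
  refine ⟨2, fun b => formOf symExp (coef s(a, b)), fun b => ?_, ?_, fun v' hv' h => ?_⟩
  · refine formOf_isWeightedHomogeneous (fun q => ?_) _
    change Finsupp.weight (fun _ => 1) _ = 2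
    rw [← Finsupp.degree_eq_weight_one]
    exact degree_symExp q
  · refine Function.ne_iff.mpr ⟨a, ?_⟩
    rw [heval, hT]
    exact mul_ne_zero hc (mul_ne_zero ha ha)
  · obtain ⟨w', hw', c', h1, hc', hT'⟩ := hrel v' hv'
    rw [h1, eq_comm, Projectivization.mk_eq_mk_iff']
    refine ⟨c' * w' a, funext fun b => ?_⟩
    rw [heval, hT']
    simp [mul_assoc]

theorem mem_AutP2 (α : Equiv.Perm (CP 2))
    (T : (Sym2 (Fin 3) → ℂ) ≃ₗ[ℂ] (Sym2 (Fin 3) → ℂ))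
    (hα : ∀ x, veroneseEmb (α x) = projMap T (veroneseEmb x)) : α ∈ AutP2 := by
  refine ⟨isRegularMap_of_veroneseEmb α T hα, isRegularMap_of_veroneseEmb α.symm T.symm fun x => ?_⟩
  have := hα (α.symm x)
  rw [Equiv.apply_symm_apply] at this
  rw [this, projMap_symm_projMap]

theorem veroneseEmb_projPerm (B : GL (Fin (k + 1)) ℂ) (x : CP k) :
    veroneseEmb (projPerm B x) = projMap (symEquiv B) (veroneseEmb x) := by
  induction x using Projectivization.ind with
  | h v hv =>
    rw [projPerm_mk, veroneseEmb_mk, veroneseEmb_mk, projMap_mk]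
    simp only [symEquiv_veroneseVec]

theorem Straightens.veroneseEmb {s : Equiv.Perm (Fin (k + 1))} {B : GL (Fin (k + 1)) ℂ}
    (h : Straightens s B) (x : CP k) :
    projConjPerm (symPerm s) (veroneseEmb (projPerm B x)) =
      RealToric.veroneseEmb (projPerm B (conjP k x)) := by
  induction x using Projectivization.ind with
  | h v hv =>
    rw [projPerm_mk, veroneseEmb_mk, conjP_mk, projPerm_mk, veroneseEmb_mk, projConjPerm_mk]
    congr 1
    funext q
    rw [conjPerm_apply, conj_veroneseVec_symPerm]
    congr 1
    exact funext fun i => h v i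

/-- The characters of the torus given by the homogeneous coordinates of the plane. -/
def planeExp : Fin 3 → Fin 2 → ℤ := ![![1, 0], ![0, 1], 0]

/-- The lattice points of the triangle, labelled by the quadratic monomials. -/
def triangleExp (q : Sym2 (Fin 3)) : Fin 2 → ℤ := (q.map planeExp).add - 1

theorem torusVec_triangleExp (t : Torus) :
    torusVec triangleExp t =
      (character 1 t)⁻¹ • veroneseVec fun a => character (planeExp a) t := by
  funext q
  induction q using Sym2.ind with
  | _ a b =>
    have : triangleExp s(a, b) = planeExp a + planeExp b + -1 := sub_eq_add_neg _ _
    rw [torusVec, this, character_add, character_add, character_neg]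
    simp [mul_comm]

theorem isToricModel_veroneseEmb :
    IsToricModel (veroneseEmb (k := 2)) triangleExp (veroneseRel (Fin 3)) where
  injective := veroneseEmb_injective
  mem_range y hy := by
    rw [mk_mem_range_veroneseEmb]
    constructor
    · rintro ⟨c, v, -, -, rfl⟩ r ⟨a, b, d, e, rfl⟩
      simp
      ring
    · intro h
      exact exists_eq_smul_veroneseVec hy fun a b c d => h _ ⟨a, b, c, d, rfl⟩
  torus t := by
    rintro r ⟨a, b, d, e, rfl⟩
    rw [torusVec_triangleExp]
    simp
    ring
  dense y hy hmem := by
    rw [mk_mem_range_veroneseEmb] at hmem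
    obtain ⟨c, v, hv, hc, rfl⟩ := hmem
    -- Adding a small `ε ≠ 0` to every coordinate makes all of them nonzero, so the perturbed point
    -- lies on the torus orbit; ratios to the last coordinate give its torus coordinates.
    have hlim : Tendsto (fun ε : ℂ => c • veroneseVec (v + fun _ => ε)) (𝓝[≠] 0)
        (𝓝 (c • veroneseVec v)) :=
      ((continuous_veroneseVec.tendsto v).comp (tendsto_add_smul_one v)).const_smul c
    refine mem_closure_of_tendsto hlim ?_
    filter_upwards [eventually_add_ne_zero (v 0), eventually_add_ne_zero (v 1),
      eventually_add_ne_zero (v 2)] with ε h0 h1 h2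
    set t : Torus := ![Units.mk0 _ h0 / Units.mk0 _ h2, Units.mk0 _ h1 / Units.mk0 _ h2] with ht
    have hchar : (v + fun _ => ε) = (v 2 + ε) • fun a => character (planeExp a) t := by
      funext a
      fin_cases a <;>
        simp [character, planeExp, ht] <;> field_simp
    refine ⟨c * (v 2 + ε) ^ 2 * character 1 t, t,
      mul_ne_zero (mul_ne_zero hc (pow_ne_zero 2 h2)) (character_ne_zero _ t), ?_⟩
    rw [hchar, veroneseVec_smul, torusVec_triangleExp, smul_smul, smul_smul, mul_assoc,
      mul_assoc, mul_inv_cancel₀ (character_ne_zero 1 t), mul_one]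

theorem exists_triangleExp_eq (v : Fin 2 → ℤ) (hv : (fun j => (v j : ℝ)) ∈ trianglePolygon) :
    ∃ q, triangleExp q = v := by
  have hsub : trianglePolygon ⊆ {x : Fin 2 → ℝ | -1 ≤ x 0 ∧ -1 ≤ x 1 ∧ x 0 + x 1 ≤ 0} := by
    refine convexHull_min ?_ ?_
    · rintro x (rfl | rfl | rfl) <;> norm_num
    · intro x hx y hy a b ha hb hab
      simp only [Set.mem_ofPred_eq, Pi.add_apply, Pi.smul_apply, smul_eq_mul] at *
      obtain rfl : b = 1 - a := by linarith
      refine ⟨?_, ?_, ?_⟩ <;> nlinarith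
  obtain ⟨h0, h1, h2⟩ := hsub hv
  have h0' : -1 ≤ v 0 := by
    have : (-1 : ℝ) ≤ v 0 := h0
    exact_mod_cast this
  have h1' : -1 ≤ v 1 := by
    have : (-1 : ℝ) ≤ v 1 := h1
    exact_mod_cast this
  have h2' : v 0 + v 1 ≤ 0 := by
    have : (v 0 : ℝ) + v 1 ≤ 0 := h2
    exact_mod_cast this
  have h3 : v 0 ≤ 1 := by linarith
  have h4 : v 1 ≤ 1 := by linarith
  have hvv : v = ![v 0, v 1] := by funext j; fin_cases j <;> rfl
  rw [hvv]
  generalize v 0 = x at *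
  generalize v 1 = y at *
  -- Of the nine candidates, those with `x + y > 0` are contradictory; the other six are the
  -- exponents.
  interval_cases x <;> interval_cases y <;> first | omega | decide

theorem isVeronese_normal_form {X : Set (CP 5)} {φ : CP 2 ≃ X} (h : IsVeronese φ) :
    IsNondegenerate X ∧ ∃ H : (Sym2 (Fin 3) → ℂ) ≃ₗ[ℂ] (Fin 6 → ℂ),
      ∀ x, (φ x : CP 5) = projMap H (veroneseEmb x) := by
  obtain ⟨F, hF, hspan, hφ⟩ := h
  obtain ⟨H, hH⟩ := exists_linearEquiv_eval symExp_injective (by rw [Sym2.card]; rfl) F hF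
    fun i d hd => by
      have hi : F i ∈ MvPolynomial.homogeneousSubmodule (Fin 3) ℂ 2 :=
        hspan ▸ Submodule.subset_span ⟨i, rfl⟩
      refine mem_range_symExp ?_
      rw [Finsupp.degree_eq_weight_one]
      exact hi hd
  have hH' : ∀ x : Fin 3 → ℂ, (fun i => MvPolynomial.eval x (F i)) = H (veroneseVec x) := by
    intro x
    rw [hH]
    congr 1
    funext q
    rw [eval_monomial_symExp]
  refine ⟨isNondegenerate_of_linearIndependent F hF fun x => ?_, H, fun x => ?_⟩
  · by_cases hx : x = 0
    · left
      rw [hH', hx, show veroneseVec (0 : Fin 3 → ℂ) = 0 from ?_, map_zero]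
      simpa using veroneseVec_smul 0 (0 : Fin 3 → ℂ)
    · obtain ⟨h1, h2⟩ := hφ x hx
      exact Or.inr ⟨h1, h2 ▸ (φ _).2⟩
  · induction x using Projectivization.ind with
    | h v hv =>
      obtain ⟨h1, h2⟩ := hφ v hv
      rw [h2, veroneseEmb_mk, projMap_mk]
      simp only [hH']

theorem triangleInvolutions_exists_parametrization {X : Set (CP 5)} {φ : CP 2 ≃ X}
    (h : IsVeronese φ) {σ : X → X} (hσ : σ ∈ triangleInvolutions X) :
    ∃ (ψ : CP 2 ≃ X) (K : (Sym2 (Fin 3) → ℂ) ≃ₗ[ℂ] (Fin 6 → ℂ)),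
      (∀ z, (ψ z : CP 5) = projMap K (veroneseEmb z)) ∧ ∀ z, σ (ψ z) = ψ (conjP 2 z) := by
  obtain ⟨hX, H, hφ⟩ := isVeronese_normal_form h
  obtain ⟨⟨-, hanti⟩, hact⟩ := hσ
  have key : ∀ (M : Matrix (Fin 2) (Fin 2) ℤ) (s : Equiv.Perm (Fin 3)),
      ActsAs σ trianglePolygon M → (∀ q, triangleExp (symPerm s q) = M.mulVec (triangleExp q)) →
      (∃ B, Straightens s B) → ∃ (ψ : CP 2 ≃ X) (K : (Sym2 (Fin 3) → ℂ) ≃ₗ[ℂ] (Fin 6 → ℂ)),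
      (∀ z, (ψ z : CP 5) = projMap K (veroneseEmb z)) ∧ ∀ z, σ (ψ z) = ψ (conjP 2 z) := by
    rintro M s hM hs ⟨B, hB⟩
    exact hM.exists_equivariant_parametrization isToricModel_veroneseEmb hanti hX
      (by rw [Sym2.card]; rfl) exists_triangleExp_eq φ H hφ (symPerm s) hs (symEquiv B)
      (projPerm B) (veroneseEmb_projPerm B) (conjP 2) hB.veroneseEmb
  -- Exchanging the two torus characters is the transposition of the first two homogeneous
  -- coordinates of the plane.
  rcases hact with hM | hM
  · exact key _ 1 hM (by decide) ⟨1, straightens_one⟩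
  · exact key _ (Equiv.swap 0 1) hM (by decide) exists_straightens_swap_three

end Veronese

/-! ### The double Segre surface -/

section Segre

variable {σ τ I J : Type*}

/-- The vector of the products `v a * v b * w c * w d`. -/
def segreVec (v : σ → ℂ) (w : τ → ℂ) : Sym2 σ × Sym2 τ → ℂ :=
  fun q => veroneseVec v q.1 * veroneseVec w q.2

theorem segreVec_mk (v : σ → ℂ) (w : τ → ℂ) (q : Sym2 σ) (r : Sym2 τ) :
    segreVec v w (q, r) = veroneseVec v q * veroneseVec w r := rfl

theorem segreVec_ne_zero {v : σ → ℂ} {w : τ → ℂ} (hv : v ≠ 0) (hw : w ≠ 0) :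
    segreVec v w ≠ 0 := by
  obtain ⟨q, hq⟩ := Function.ne_iff.mp (veroneseVec_ne_zero hv)
  obtain ⟨r, hr⟩ := Function.ne_iff.mp (veroneseVec_ne_zero hw)
  exact Function.ne_iff.mpr ⟨(q, r), mul_ne_zero hq hr⟩

theorem segreVec_smul_smul (a b : ℂ) (v : σ → ℂ) (w : τ → ℂ) :
    segreVec (a • v) (b • w) = (a ^ 2 * b ^ 2) • segreVec v w := by
  funext q
  simp only [segreVec, veroneseVec_smul, Pi.smul_apply, smul_eq_mul]
  ring

theorem continuous_segreVec :
    Continuous fun p : (σ → ℂ) × (τ → ℂ) => segreVec p.1 p.2 :=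
  continuous_pi fun q =>
    ((continuous_apply q.1).comp (continuous_veroneseVec.comp continuous_fst)).mul
      ((continuous_apply q.2).comp (continuous_veroneseVec.comp continuous_snd))

theorem veroneseVec_smul_eq_of_segreVec_left {v v' : σ → ℂ} {w w' : τ → ℂ} (hw : w ≠ 0) {a : ℂ}
    (h : a • segreVec v' w' = segreVec v w) : ∃ b : ℂ, b • veroneseVec v' = veroneseVec v := by
  obtain ⟨r, hr⟩ := Function.ne_iff.mp (veroneseVec_ne_zero hw)
  simp only [Pi.zero_apply] at hr
  refine ⟨a * veroneseVec w' r / veroneseVec w r, funext fun q => ?_⟩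
  have := congrFun h (q, r)
  simp only [Pi.smul_apply, smul_eq_mul, segreVec_mk] at this ⊢
  field_simp
  linear_combination this

theorem veroneseVec_smul_eq_of_segreVec_right {v v' : σ → ℂ} {w w' : τ → ℂ} (hv : v ≠ 0) {a : ℂ}
    (h : a • segreVec v' w' = segreVec v w) : ∃ b : ℂ, b • veroneseVec w' = veroneseVec w := by
  obtain ⟨q, hq⟩ := Function.ne_iff.mp (veroneseVec_ne_zero hv)
  simp only [Pi.zero_apply] at hq
  refine ⟨a * veroneseVec v' q / veroneseVec v q, funext fun r => ?_⟩
  have := congrFun h (q, r)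
  simp only [Pi.smul_apply, smul_eq_mul, segreVec_mk] at this ⊢
  field_simp
  linear_combination this

/-- The index set of quadrics containing the double Segre variety. -/
def segreRel (σ τ : Type*) : Set ((Sym2 σ × Sym2 τ) × (Sym2 σ × Sym2 τ) ×
    (Sym2 σ × Sym2 τ) × (Sym2 σ × Sym2 τ)) :=
  {r | (∃ a b c d q q', r = ((s(a, b), q), (s(c, d), q'), (s(a, c), q), (s(b, d), q'))) ∨
    ∃ a b c d q q', r = ((q, s(a, b)), (q', s(c, d)), (q, s(a, c)), (q', s(b, d)))}

theorem smul_segreVec_segreRel (c : ℂ) (v : σ → ℂ) (w : τ → ℂ) :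
    ∀ r ∈ segreRel σ τ, (c • segreVec v w) r.1 * (c • segreVec v w) r.2.1 =
      (c • segreVec v w) r.2.2.1 * (c • segreVec v w) r.2.2.2 := by
  rintro r (⟨a, b, d, e, q, q', rfl⟩ | ⟨a, b, d, e, q, q', rfl⟩) <;>
    · simp only [Pi.smul_apply, segreVec_mk, veroneseVec_mk, smul_eq_mul]
      ring

/-- The rank-one argument is applied in both factors: a nonzero entry yields a nonzero doubly
diagonal entry `y₀ = y_{aa,cc}`. The vectors are `v_e = y_{ae,cc}` and `w_g = y_{aa,cg}`. -/
theorem exists_eq_smul_segreVec {y : Sym2 σ × Sym2 τ → ℂ} (hy : y ≠ 0)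
    (h : ∀ r ∈ segreRel σ τ, y r.1 * y r.2.1 = y r.2.2.1 * y r.2.2.2) :
    ∃ (c : ℂ) (v : σ → ℂ) (w : τ → ℂ), v ≠ 0 ∧ w ≠ 0 ∧ c ≠ 0 ∧ y = c • segreVec v w := by
  have h1 : ∀ a b c d q q',
      y (s(a, b), q) * y (s(c, d), q') = y (s(a, c), q) * y (s(b, d), q') :=
    fun a b c d q q' => h _ (Or.inl ⟨a, b, c, d, q, q', rfl⟩)
  have h2 : ∀ a b c d q q',
      y (q, s(a, b)) * y (q', s(c, d)) = y (q, s(a, c)) * y (q', s(b, d)) :=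
    fun a b c d q q' => h _ (Or.inr ⟨a, b, c, d, q, q', rfl⟩)
  obtain ⟨⟨q, r⟩, hq⟩ := Function.ne_iff.mp hy
  induction q using Sym2.ind with
  | _ a b =>
    induction r using Sym2.ind with
    | _ c d =>
      have ha : y (s(a, a), s(c, d)) ≠ 0 := fun h0 => by
        have := h1 a a b b s(c, d) s(c, d)
        rw [h0, zero_mul] at this
        exact hq (mul_self_eq_zero.mp this.symm)
      have hac : y (s(a, a), s(c, c)) ≠ 0 := fun h0 => by
        have := h2 c c d d s(a, a) s(a, a)
        rw [h0, zero_mul] at this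
        exact ha (mul_self_eq_zero.mp this.symm)
      -- The relations give `v_e v_f = y₀ y_{ef,cc}`, `w_g w_k = y₀ y_{aa,gk}` and `y_{ef,cc}
      -- y_{aa,gk} = y₀ y_{ef,gk}`, whence the factor `y₀⁻³`.
      refine ⟨(y (s(a, a), s(c, c)) ^ 3)⁻¹, fun e => y (s(a, e), s(c, c)),
        fun e => y (s(a, a), s(c, e)), fun h0 => hac (congrFun h0 a),
        fun h0 => hac (congrFun h0 c), inv_ne_zero (pow_ne_zero 3 hac), ?_⟩
      funext ⟨q, r⟩
      induction q using Sym2.ind with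
      | _ e f =>
        induction r using Sym2.ind with
        | _ g k =>
          rw [Pi.smul_apply, segreVec_mk, veroneseVec_mk, veroneseVec_mk, smul_eq_mul,
            eq_inv_mul_iff_mul_eq₀ (pow_ne_zero 3 hac)]
          have e1 := h1 a a e f s(c, c) s(c, c)
          have e2 := h2 c c g k s(a, a) s(a, a)
          have e3 := h1 a a e f s(c, c) s(g, k)
          have e5 := h1 e f a a s(c, c) s(g, k)
          rw [Sym2.eq_swap (a := e) (b := a), Sym2.eq_swap (a := f) (b := a)] at e5
          rw [← e1, ← e2]
          linear_combination y (s(a, a), s(c, c)) ^ 2 * (e3 - e5)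

/-- A linear isomorphism applied to the first index. -/
def leftEquiv (E : (I → ℂ) ≃ₗ[ℂ] (I → ℂ)) : (I × J → ℂ) ≃ₗ[ℂ] (I × J → ℂ) where
  toFun y q := E (fun i => y (i, q.2)) q.1
  invFun y q := E.symm (fun i => y (i, q.2)) q.1
  map_add' y y' := by
    funext q
    exact congrFun (map_add E (fun i => y (i, q.2)) fun i => y' (i, q.2)) q.1
  map_smul' c y := by
    funext q
    exact congrFun (map_smul E c fun i => y (i, q.2)) q.1
  left_inv y := by simp
  right_inv y := by simp

/-- A linear isomorphism applied to the second index. -/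
def rightEquiv (E : (J → ℂ) ≃ₗ[ℂ] (J → ℂ)) : (I × J → ℂ) ≃ₗ[ℂ] (I × J → ℂ) where
  toFun y q := E (fun j => y (q.1, j)) q.2
  invFun y q := E.symm (fun j => y (q.1, j)) q.2
  map_add' y y' := by
    funext q
    exact congrFun (map_add E (fun j => y (q.1, j)) fun j => y' (q.1, j)) q.2
  map_smul' c y := by
    funext q
    exact congrFun (map_smul E c fun j => y (q.1, j)) q.2
  left_inv y := by simp
  right_inv y := by simp

theorem leftEquiv_mul (E : (I → ℂ) ≃ₗ[ℂ] (I → ℂ)) (y : I → ℂ) (z : J → ℂ) :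
    leftEquiv E (fun q => y q.1 * z q.2) = fun q => E y q.1 * z q.2 := by
  funext q
  have := congrFun (map_smul E (z q.2) y) q.1
  simp only [Pi.smul_apply, smul_eq_mul] at this
  rw [mul_comm, ← this]
  change E _ q.1 = _
  exact congrFun (congrArg E (funext fun i => mul_comm _ _)) _

theorem rightEquiv_mul (E : (J → ℂ) ≃ₗ[ℂ] (J → ℂ)) (y : I → ℂ) (z : J → ℂ) :
    rightEquiv E (fun q => y q.1 * z q.2) = fun q => y q.1 * E z q.2 := by
  funext q
  have := congrFun (map_smul E (y q.1) z) q.2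
  simp only [Pi.smul_apply, smul_eq_mul] at this
  rw [← this]
  rfl

/-- The action of a pair of invertible matrices on the coordinates `v a * v b * w c * w d`. -/
def segreEquiv [Fintype σ] [DecidableEq σ] [Fintype τ] [DecidableEq τ] (B : GL σ ℂ) (C : GL τ ℂ) :
    (Sym2 σ × Sym2 τ → ℂ) ≃ₗ[ℂ] (Sym2 σ × Sym2 τ → ℂ) :=
  (leftEquiv (symEquiv B)).trans (rightEquiv (symEquiv C))

theorem segreEquiv_segreVec [Fintype σ] [DecidableEq σ] [Fintype τ] [DecidableEq τ] (B : GL σ ℂ)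
    (C : GL τ ℂ) (v : σ → ℂ) (w : τ → ℂ) :
    segreEquiv B C (segreVec v w) = segreVec (B.val.mulVec v) (C.val.mulVec w) := by
  rw [segreEquiv, LinearEquiv.trans_apply]
  unfold segreVec
  rw [leftEquiv_mul, rightEquiv_mul, symEquiv_veroneseVec, symEquiv_veroneseVec]

/-- The exponent of the monomial of bidegree `(2, 2)` given by two unordered pairs. -/
def segreExp (q : Sym2 σ × Sym2 τ) : σ ⊕ τ →₀ ℕ := (symExp q.1).sumElim (symExp q.2)

theorem segreExp_injective : Function.Injective (segreExp : Sym2 σ × Sym2 τ → σ ⊕ τ →₀ ℕ) := by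
  intro q r h
  refine Prod.ext (symExp_injective (Finsupp.ext fun i => ?_))
    (symExp_injective (Finsupp.ext fun i => ?_))
  · exact DFunLike.congr_fun h (Sum.inl i)
  · exact DFunLike.congr_fun h (Sum.inr i)

theorem eval_monomial_segreExp (v : σ → ℂ) (w : τ → ℂ) (q : Sym2 σ × Sym2 τ) :
    MvPolynomial.eval (Sum.elim v w) (MvPolynomial.monomial (segreExp q) 1) = segreVec v w q := by
  rw [MvPolynomial.eval_monomial, one_mul, segreExp, Finsupp.prod_sumElim, segreVec,
    ← prod_symExp, ← prod_symExp]
  rfl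

theorem weight_biWeight (d : Fin 2 ⊕ Fin 2 →₀ ℕ) :
    Finsupp.weight biWeight d =
      (d (Sum.inl 0) + d (Sum.inl 1), d (Sum.inr 0) + d (Sum.inr 1)) := by
  rw [Finsupp.weight_apply, Finsupp.sum_fintype _ _ (by simp), Fintype.sum_sum_type]
  simp [biWeight]

theorem weight_segreExp (q : Sym2 (Fin 2) × Sym2 (Fin 2)) :
    Finsupp.weight biWeight (segreExp q) = (2, 2) := by
  have h1 := degree_symExp q.1
  have h2 := degree_symExp q.2
  rw [Finsupp.degree_eq_sum, Fin.sum_univ_two] at h1 h2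
  rw [weight_biWeight]
  exact Prod.ext h1 h2

theorem mem_range_segreExp {d : Fin 2 ⊕ Fin 2 →₀ ℕ} (hd : Finsupp.weight biWeight d = (2, 2)) :
    d ∈ Set.range segreExp := by
  rw [weight_biWeight, Prod.mk.injEq] at hd
  obtain ⟨q, hq⟩ := mem_range_symExp
    (d := Finsupp.equivFunOnFinite.symm fun i => d (Sum.inl i))
    (by rw [Finsupp.degree_eq_sum, Fin.sum_univ_two]; exact hd.1)
  obtain ⟨r, hr⟩ := mem_range_symExp
    (d := Finsupp.equivFunOnFinite.symm fun i => d (Sum.inr i))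
    (by rw [Finsupp.degree_eq_sum, Fin.sum_univ_two]; exact hd.2)
  refine ⟨(q, r), Finsupp.ext ?_⟩
  rintro (i | i)
  · exact DFunLike.congr_fun hq i
  · exact DFunLike.congr_fun hr i

/-- The embedding of `ℙ¹ × ℙ¹` by the forms of bidegree `(2, 2)`. -/
def segreEmb (x : CP 1 × CP 1) : CoordP (Sym2 (Fin 2) × Sym2 (Fin 2)) :=
  Projectivization.mk ℂ (segreVec x.1.rep x.2.rep)
    (segreVec_ne_zero x.1.rep_nonzero x.2.rep_nonzero)

theorem segreEmb_mk (v w : Fin 2 → ℂ) (hv : v ≠ 0) (hw : w ≠ 0) :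
    segreEmb (Projectivization.mk ℂ v hv, Projectivization.mk ℂ w hw) =
      Projectivization.mk ℂ (segreVec v w) (segreVec_ne_zero hv hw) := by
  obtain ⟨a, ha⟩ := Projectivization.exists_smul_eq_mk_rep ℂ v hv
  obtain ⟨b, hb⟩ := Projectivization.exists_smul_eq_mk_rep ℂ w hw
  rw [segreEmb, Projectivization.mk_eq_mk_iff']
  exact ⟨(a : ℂ) ^ 2 * (b : ℂ) ^ 2, by rw [← segreVec_smul_smul, ← ha, ← hb]; rfl⟩

theorem CP.prod_ind {P : CP 1 × CP 1 → Prop}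
    (h : ∀ (v w : Fin 2 → ℂ) (hv : v ≠ 0) (hw : w ≠ 0),
      P (Projectivization.mk ℂ v hv, Projectivization.mk ℂ w hw)) (x : CP 1 × CP 1) : P x := by
  have := h x.1.rep x.2.rep x.1.rep_nonzero x.2.rep_nonzero
  rwa [Projectivization.mk_rep, Projectivization.mk_rep] at this

theorem segreEmb_injective : Function.Injective segreEmb := by
  intro x y
  induction x using CP.prod_ind with | h v w hv hw => ?_
  induction y using CP.prod_ind with | h v' w' hv' hw' => ?_
  intro h
  rw [segreEmb_mk, segreEmb_mk, Projectivization.mk_eq_mk_iff'] at h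
  obtain ⟨a, ha⟩ := h
  obtain ⟨b, hb⟩ := veroneseVec_smul_eq_of_segreVec_left hw ha
  obtain ⟨c, hc⟩ := veroneseVec_smul_eq_of_segreVec_right hv ha
  exact Prod.ext (mk_eq_mk_of_veroneseVec hv hv' hb) (mk_eq_mk_of_veroneseVec hw hw' hc)

theorem mk_mem_range_segreEmb (y : Sym2 (Fin 2) × Sym2 (Fin 2) → ℂ) (hy : y ≠ 0) :
    Projectivization.mk ℂ y hy ∈ Set.range segreEmb ↔
      ∃ (c : ℂ) (v w : Fin 2 → ℂ), v ≠ 0 ∧ w ≠ 0 ∧ c ≠ 0 ∧ y = c • segreVec v w := by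
  constructor
  · rintro ⟨x, hx⟩
    induction x using CP.prod_ind with | h v w hv hw => ?_
    rw [segreEmb_mk, eq_comm, Projectivization.mk_eq_mk_iff'] at hx
    obtain ⟨a, rfl⟩ := hx
    exact ⟨a, v, w, hv, hw, fun h => hy (by rw [h, zero_smul]), rfl⟩
  · rintro ⟨c, v, w, hv, hw, hc, rfl⟩
    refine ⟨(Projectivization.mk ℂ v hv, Projectivization.mk ℂ w hw), ?_⟩
    rw [segreEmb_mk, eq_comm, Projectivization.mk_eq_mk_iff']
    exact ⟨c, rfl⟩

/-- As for the Veronese embedding, each component is read off from the entries of `T (segreVec v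
w)`: freeze one index of its own pair and put the other factor on a diagonal entry that does not
vanish at the given point. -/
theorem isRegularSelfMap_of_segreEmb (α : CP 1 × CP 1 → CP 1 × CP 1)
    (T : (Sym2 (Fin 2) × Sym2 (Fin 2) → ℂ) ≃ₗ[ℂ] (Sym2 (Fin 2) × Sym2 (Fin 2) → ℂ))
    (hα : ∀ x, segreEmb (α x) = projMap T (segreEmb x)) : IsRegularSelfMap α := by
  choose coef hcoef using exists_coord_eq_sum T.toLinearMap
  simp only [LinearEquiv.coe_coe] at hcoef
  have heval : ∀ q v w, MvPolynomial.eval (Sum.elim v w) (formOf segreExp (coef q)) =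
      T (segreVec v w) q := by
    intro q v w
    rw [eval_formOf, hcoef]
    simp only [eval_monomial_segreExp]
  have hhom : ∀ q, (formOf segreExp (coef q)).IsWeightedHomogeneous biWeight (2, 2) :=
    fun q => formOf_isWeightedHomogeneous weight_segreExp _
  have hrel : ∀ v w (hv : v ≠ 0) (hw : w ≠ 0), ∃ v', ∃ hv' : v' ≠ 0, ∃ w', ∃ hw' : w' ≠ 0,
      ∃ c : ℂ, α (Projectivization.mk ℂ v hv, Projectivization.mk ℂ w hw) =
          (Projectivization.mk ℂ v' hv', Projectivization.mk ℂ w' hw') ∧ c ≠ 0 ∧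
        T (segreVec v w) = c • segreVec v' w' := by
    intro v w hv hw
    refine ⟨_, (α (Projectivization.mk ℂ v hv, Projectivization.mk ℂ w hw)).1.rep_nonzero,
      _, (α (Projectivization.mk ℂ v hv, Projectivization.mk ℂ w hw)).2.rep_nonzero, ?_⟩
    have h := hα (Projectivization.mk ℂ v hv, Projectivization.mk ℂ w hw)
    rw [segreEmb_mk, projMap_mk, segreEmb, eq_comm, Projectivization.mk_eq_mk_iff'] at h
    obtain ⟨c, hc⟩ := h
    refine ⟨c, by rw [Projectivization.mk_rep, Projectivization.mk_rep], ?_, hc.symm⟩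
    rintro rfl
    rw [zero_smul] at hc
    exact (map_ne_zero_iff T T.injective).mpr (segreVec_ne_zero hv hw) hc.symm
  constructor <;>
  · intro v w hv hw
    obtain ⟨v₁, hv₁, w₁, hw₁, c, -, hc, hT⟩ := hrel v w hv hw
    obtain ⟨a, ha⟩ := Function.ne_iff.mp hv₁
    obtain ⟨a', ha'⟩ := Function.ne_iff.mp hw₁
    -- The first alternative recovers the component in the first line, the second that in the second
    -- line.
    first
    | refine ⟨(2, 2), fun b => formOf segreExp (coef (s(a, b), s(a', a'))),
        fun b => hhom _, ?_, fun v' w' hv' hw' h => ?_⟩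
      · refine Function.ne_iff.mpr ⟨a, ?_⟩
        rw [heval, hT]
        exact mul_ne_zero hc (mul_ne_zero (mul_ne_zero ha ha) (mul_ne_zero ha' ha'))
      · obtain ⟨v₂, hv₂, w₂, hw₂, c₂, h1, hc₂, hT₂⟩ := hrel v' w' hv' hw'
        simp only [h1]
        rw [eq_comm, Projectivization.mk_eq_mk_iff']
        refine ⟨c₂ * v₂ a * (w₂ a' * w₂ a'), funext fun b => ?_⟩
        rw [heval, hT₂]
        simp only [Pi.smul_apply, segreVec_mk, veroneseVec_mk, smul_eq_mul]
        ring
    | refine ⟨(2, 2), fun b => formOf segreExp (coef (s(a, a), s(a', b))),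
        fun b => hhom _, ?_, fun v' w' hv' hw' h => ?_⟩
      · refine Function.ne_iff.mpr ⟨a', ?_⟩
        rw [heval, hT]
        exact mul_ne_zero hc (mul_ne_zero (mul_ne_zero ha ha) (mul_ne_zero ha' ha'))
      · obtain ⟨v₂, hv₂, w₂, hw₂, c₂, h1, hc₂, hT₂⟩ := hrel v' w' hv' hw'
        simp only [h1]
        rw [eq_comm, Projectivization.mk_eq_mk_iff']
        refine ⟨c₂ * w₂ a' * (v₂ a * v₂ a), funext fun b => ?_⟩
        rw [heval, hT₂]
        simp only [Pi.smul_apply, segreVec_mk, veroneseVec_mk, smul_eq_mul]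
        ring

theorem mem_AutP1P1 (α : Equiv.Perm (CP 1 × CP 1))
    (T : (Sym2 (Fin 2) × Sym2 (Fin 2) → ℂ) ≃ₗ[ℂ] (Sym2 (Fin 2) × Sym2 (Fin 2) → ℂ))
    (hα : ∀ x, segreEmb (α x) = projMap T (segreEmb x)) : α ∈ AutP1P1 := by
  refine ⟨isRegularSelfMap_of_segreEmb α T hα,
    isRegularSelfMap_of_segreEmb α.symm T.symm fun x => ?_⟩
  have := hα (α.symm x)
  rw [Equiv.apply_symm_apply] at this
  rw [this, projMap_symm_projMap]

theorem segreEmb_projPerm (B C : GL (Fin 2) ℂ) (x : CP 1 × CP 1) :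
    segreEmb (Equiv.prodCongr (projPerm B) (projPerm C) x) =
      projMap (segreEquiv B C) (segreEmb x) := by
  induction x using CP.prod_ind with | h v w hv hw => ?_
  rw [Equiv.prodCongr_apply, Prod.map_apply, projPerm_mk, projPerm_mk, segreEmb_mk, segreEmb_mk,
    projMap_mk]
  simp only [segreEquiv_segreVec]

theorem Straightens.segreEmb {s s' : Equiv.Perm (Fin 2)} {B B' : GL (Fin 2) ℂ}
    (h : Straightens s B) (h' : Straightens s' B') (x : CP 1 × CP 1) :
    projConjPerm (Equiv.prodCongr (symPerm s) (symPerm s'))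
        (segreEmb (Equiv.prodCongr (projPerm B) (projPerm B') x)) =
      RealToric.segreEmb
        (Equiv.prodCongr (projPerm B) (projPerm B') (Prod.map (conjP 1) (conjP 1) x)) := by
  induction x using CP.prod_ind with | h v w hv hw => ?_
  rw [Prod.map_apply, Equiv.prodCongr_apply, Prod.map_apply, Prod.map_apply, projPerm_mk,
    projPerm_mk, conjP_mk, conjP_mk, projPerm_mk, projPerm_mk, segreEmb_mk, segreEmb_mk,
    projConjPerm_mk]
  congr 1
  funext ⟨q, r⟩
  rw [conjPerm_apply, Equiv.prodCongr_apply, Prod.map_apply, segreVec_mk, map_mul,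
    conj_veroneseVec_symPerm, conj_veroneseVec_symPerm, segreVec_mk]
  congr 2
  · exact funext fun i => h v i
  · exact funext fun i => h' w i

/-- The degree in the first variable, minus one. -/
def lineExp (q : Sym2 (Fin 2)) : ℤ := (q.map ![1, 0]).add - 1

/-- The lattice points of the square, labelled by the monomials of bidegree `(2, 2)`. -/
def squareExp (q : Sym2 (Fin 2) × Sym2 (Fin 2)) : Fin 2 → ℤ := ![lineExp q.1, lineExp q.2]

theorem zpow_lineExp (t : ℂˣ) (q : Sym2 (Fin 2)) :
    ((t ^ lineExp q : ℂˣ) : ℂ) = (t : ℂ)⁻¹ * veroneseVec ![(t : ℂ), 1] q := by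
  have ht := t.ne_zero
  induction q using Sym2.ind with
  | _ a b =>
    fin_cases a <;> fin_cases b <;> simp [lineExp]

theorem torusVec_squareExp (t : Torus) :
    torusVec squareExp t =
      ((t 0 : ℂ)⁻¹ * (t 1 : ℂ)⁻¹) • segreVec ![(t 0 : ℂ), 1] ![(t 1 : ℂ), 1] := by
  funext ⟨q, r⟩
  have : torusVec squareExp t (q, r) =
      ((t 0 ^ lineExp q : ℂˣ) : ℂ) * ((t 1 ^ lineExp r : ℂˣ) : ℂ) := by
    simp [torusVec, character, squareExp]
  rw [this, zpow_lineExp, zpow_lineExp, Pi.smul_apply, segreVec_mk, smul_eq_mul]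
  ring

theorem isToricModel_segreEmb : IsToricModel segreEmb squareExp (segreRel (Fin 2) (Fin 2)) where
  injective := segreEmb_injective
  mem_range y hy := by
    rw [mk_mem_range_segreEmb]
    constructor
    · rintro ⟨c, v, w, -, -, -, rfl⟩
      exact smul_segreVec_segreRel c v w
    · exact exists_eq_smul_segreVec hy
  torus t := by
    rw [torusVec_squareExp]
    exact smul_segreVec_segreRel _ _ _
  dense y hy hmem := by
    rw [mk_mem_range_segreEmb] at hmem
    obtain ⟨c, v, w, hv, hw, hc, rfl⟩ := hmem
    -- The same perturbation in both factors moves the point onto the torus orbit, with one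
    -- coordinate ratio from each line.
    have hlim : Tendsto (fun ε : ℂ => c • segreVec (v + fun _ => ε) (w + fun _ => ε)) (𝓝[≠] 0)
        (𝓝 (c • segreVec v w)) :=
      ((continuous_segreVec.tendsto (v, w)).comp
        ((tendsto_add_smul_one v).prodMk_nhds (tendsto_add_smul_one w))).const_smul c
    refine mem_closure_of_tendsto hlim ?_
    filter_upwards [eventually_add_ne_zero (v 0), eventually_add_ne_zero (v 1),
      eventually_add_ne_zero (w 0), eventually_add_ne_zero (w 1)] with ε h0 h1 k0 k1
    set t : Torus := ![Units.mk0 _ h0 / Units.mk0 _ h1, Units.mk0 _ k0 / Units.mk0 _ k1] with ht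
    have hv' : (v + fun _ => ε) = (v 1 + ε) • ![(t 0 : ℂ), 1] := by
      funext a
      fin_cases a <;> (simp [ht]; try field_simp)
    have hw' : (w + fun _ => ε) = (w 1 + ε) • ![(t 1 : ℂ), 1] := by
      funext a
      fin_cases a <;> (simp [ht]; try field_simp)
    have ht0 := (t 0).ne_zero
    have ht1 := (t 1).ne_zero
    refine ⟨c * ((v 1 + ε) ^ 2 * (w 1 + ε) ^ 2) * (t 0 * t 1), t,
      mul_ne_zero (mul_ne_zero hc (mul_ne_zero (pow_ne_zero 2 h1) (pow_ne_zero 2 k1)))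
        (mul_ne_zero ht0 ht1), ?_⟩
    rw [hv', hw', segreVec_smul_smul, torusVec_squareExp, smul_smul, smul_smul]
    congr 1
    field_simp

theorem exists_squareExp_eq (v : Fin 2 → ℤ) (hv : (fun j => (v j : ℝ)) ∈ squarePolygon) :
    ∃ q, squareExp q = v := by
  have hsub : squarePolygon ⊆
      {x : Fin 2 → ℝ | (-1 ≤ x 0 ∧ x 0 ≤ 1) ∧ -1 ≤ x 1 ∧ x 1 ≤ 1} := by
    refine convexHull_min ?_ ?_
    · rintro x (rfl | rfl | rfl | rfl) <;> norm_num
    · intro x hx y hy a b ha hb hab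
      simp only [Set.mem_ofPred_eq, Pi.add_apply, Pi.smul_apply, smul_eq_mul] at *
      obtain rfl : b = 1 - a := by linarith
      refine ⟨⟨?_, ?_⟩, ?_, ?_⟩ <;> nlinarith
  obtain ⟨⟨h0, h1⟩, h2, h3⟩ := hsub hv
  have h0' : -1 ≤ v 0 := by
    have : (-1 : ℝ) ≤ v 0 := h0
    exact_mod_cast this
  have h1' : v 0 ≤ 1 := by
    have : (v 0 : ℝ) ≤ 1 := h1
    exact_mod_cast this
  have h2' : -1 ≤ v 1 := by
    have : (-1 : ℝ) ≤ v 1 := h2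
    exact_mod_cast this
  have h3' : v 1 ≤ 1 := by
    have : (v 1 : ℝ) ≤ 1 := h3
    exact_mod_cast this
  have hvv : v = ![v 0, v 1] := by funext j; fin_cases j <;> rfl
  rw [hvv]
  generalize v 0 = x at *
  generalize v 1 = y at *
  interval_cases x <;> interval_cases y <;> decide

theorem isDoubleSegre_normal_form {X : Set (CP 8)} {φ : CP 1 × CP 1 ≃ X} (h : IsDoubleSegre φ) :
    IsNondegenerate X ∧ ∃ H : (Sym2 (Fin 2) × Sym2 (Fin 2) → ℂ) ≃ₗ[ℂ] (Fin 9 → ℂ),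
      ∀ x, (φ x : CP 8) = projMap H (segreEmb x) := by
  obtain ⟨F, hF, hspan, hφ⟩ := h
  obtain ⟨H, hH⟩ := exists_linearEquiv_eval segreExp_injective
    (by rw [Fintype.card_prod, Sym2.card]; rfl) F hF
    fun i d hd => by
      have hi : F i ∈ MvPolynomial.weightedHomogeneousSubmodule ℂ biWeight (2, 2) :=
        hspan ▸ Submodule.subset_span ⟨i, rfl⟩
      exact mem_range_segreExp (hi hd)
  have hH' : ∀ v w : Fin 2 → ℂ,
      (fun i => MvPolynomial.eval (Sum.elim v w) (F i)) = H (segreVec v w) := by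
    intro v w
    rw [hH]
    congr 1
    funext q
    rw [eval_monomial_segreExp]
  refine ⟨isNondegenerate_of_linearIndependent F hF fun x => ?_, H, fun x => ?_⟩
  · obtain ⟨v, w, rfl⟩ : ∃ v w, x = Sum.elim v w :=
      ⟨x ∘ Sum.inl, x ∘ Sum.inr, (Sum.elim_comp_inl_inr x).symm⟩
    by_cases hv : v = 0
    · left
      rw [hH', hv, show segreVec (0 : Fin 2 → ℂ) w = 0 from ?_, map_zero]
      simpa using segreVec_smul_smul 0 1 (0 : Fin 2 → ℂ) w
    by_cases hw : w = 0
    · left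
      rw [hH', hw, show segreVec v (0 : Fin 2 → ℂ) = 0 from ?_, map_zero]
      simpa using segreVec_smul_smul 1 0 v (0 : Fin 2 → ℂ)
    · obtain ⟨h1, h2⟩ := hφ v w hv hw
      exact Or.inr ⟨h1, h2 ▸ (φ _).2⟩
  · induction x using CP.prod_ind with | h v w hv hw => ?_
    obtain ⟨h1, h2⟩ := hφ v w hv hw
    rw [h2, segreEmb_mk, projMap_mk]
    simp only [hH']

theorem squareInvolutions_exists_parametrization {X : Set (CP 8)} {φ : CP 1 × CP 1 ≃ X}
    (h : IsDoubleSegre φ) {σ : X → X} (hσ : σ ∈ squareInvolutions X) :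
    ∃ (ψ : CP 1 × CP 1 ≃ X) (K : (Sym2 (Fin 2) × Sym2 (Fin 2) → ℂ) ≃ₗ[ℂ] (Fin 9 → ℂ)),
      (∀ z, (ψ z : CP 8) = projMap K (segreEmb z)) ∧
        ∀ z, σ (ψ z) = ψ (Prod.map (conjP 1) (conjP 1) z) := by
  obtain ⟨hX, H, hφ⟩ := isDoubleSegre_normal_form h
  obtain ⟨⟨-, hanti⟩, hact⟩ := hσ
  have key : ∀ (M : Matrix (Fin 2) (Fin 2) ℤ) (s s' : Equiv.Perm (Fin 2)),
      ActsAs σ squarePolygon M →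
      (∀ q, squareExp (Equiv.prodCongr (symPerm s) (symPerm s') q) = M.mulVec (squareExp q)) →
      (∃ B, Straightens s B) → (∃ B, Straightens s' B) →
      ∃ (ψ : CP 1 × CP 1 ≃ X) (K : (Sym2 (Fin 2) × Sym2 (Fin 2) → ℂ) ≃ₗ[ℂ] (Fin 9 → ℂ)),
      (∀ z, (ψ z : CP 8) = projMap K (segreEmb z)) ∧
        ∀ z, σ (ψ z) = ψ (Prod.map (conjP 1) (conjP 1) z) := by
    rintro M s s' hM hs ⟨B, hB⟩ ⟨C, hC⟩
    exact hM.exists_equivariant_parametrization isToricModel_segreEmb hanti hX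
      (by rw [Fintype.card_prod, Sym2.card]; rfl) exists_squareExp_eq φ H hφ
      (Equiv.prodCongr (symPerm s) (symPerm s')) hs (segreEquiv B C)
      (Equiv.prodCongr (projPerm B) (projPerm C)) (segreEmb_projPerm B C)
      (Prod.map (conjP 1) (conjP 1)) (hB.segreEmb hC)
  -- Negating a lattice coordinate inverts the corresponding torus coordinate, that is, swaps the
  -- homogeneous coordinates of that line.
  rcases hact with hM | hM | hM
  · exact key _ 1 1 hM (by decide) ⟨1, straightens_one⟩ ⟨1, straightens_one⟩
  · exact key _ (Equiv.swap 0 1) 1 hM (by decide) exists_straightens_swap_two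
      ⟨1, straightens_one⟩
  · exact key _ (Equiv.swap 0 1) (Equiv.swap 0 1) hM (by decide) exists_straightens_swap_two
      exists_straightens_swap_two

end Segre

end RealToric

end

theorem corollary4 :
    (∀ (X : Set (RealToric.CP 8)) (φ : RealToric.CP 1 × RealToric.CP 1 ≃ X),
      RealToric.IsDoubleSegre φ →
        (∀ σ ∈ RealToric.squareInvolutions X, ∀ σ' ∈ RealToric.squareInvolutions X,
          RealToric.InnerAutomorphicVia φ RealToric.AutP1P1 σ σ') ∧
        (∀ σ ∈ RealToric.squareInvolutions X,
          RealToric.InnerAutomorphicVia φ RealToric.AutP1P1 σ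
            (φ ∘ Prod.map (RealToric.conjP 1) (RealToric.conjP 1) ∘ φ.symm))) ∧
    (∀ (X : Set (RealToric.CP 5)) (φ : RealToric.CP 2 ≃ X),
      RealToric.IsVeronese φ →
        (∀ σ ∈ RealToric.triangleInvolutions X, ∀ σ' ∈ RealToric.triangleInvolutions X,
          RealToric.InnerAutomorphicVia φ RealToric.AutP2 σ σ') ∧
        (∀ σ ∈ RealToric.triangleInvolutions X,
          RealToric.InnerAutomorphicVia φ RealToric.AutP2 σ
            (φ ∘ RealToric.conjP 2 ∘ φ.symm))) := by
  refine ⟨fun X φ h => ?_, fun X φ h => ?_⟩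
  · obtain ⟨-, H, hφ⟩ := RealToric.isDoubleSegre_normal_form h
    refine ⟨fun σ hσ σ' hσ' => ?_, fun σ hσ => ?_⟩
    · obtain ⟨ψ, K, hψ, hc⟩ := RealToric.squareInvolutions_exists_parametrization h hσ
      obtain ⟨ψ', K', hψ', hc'⟩ := RealToric.squareInvolutions_exists_parametrization h hσ'
      exact RealToric.innerAutomorphicVia_of_equivariant hφ RealToric.mem_AutP1P1 hψ hc hψ' hc'
    · obtain ⟨ψ, K, hψ, hc⟩ := RealToric.squareInvolutions_exists_parametrization h hσ
      -- The map `φ` itself is an equivariant parametrization for the standard real structure.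
      exact RealToric.innerAutomorphicVia_of_equivariant hφ RealToric.mem_AutP1P1 hψ hc hφ
        fun z => by simp
  · obtain ⟨-, H, hφ⟩ := RealToric.isVeronese_normal_form h
    refine ⟨fun σ hσ σ' hσ' => ?_, fun σ hσ => ?_⟩
    · obtain ⟨ψ, K, hψ, hc⟩ := RealToric.triangleInvolutions_exists_parametrization h hσ
      obtain ⟨ψ', K', hψ', hc'⟩ := RealToric.triangleInvolutions_exists_parametrization h hσ'
      exact RealToric.innerAutomorphicVia_of_equivariant hφ RealToric.mem_AutP2 hψ hc hψ' hc'
    · obtain ⟨ψ, K, hψ, hc⟩ := RealToric.triangleInvolutions_exists_parametrization h hσ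
      exact RealToric.innerAutomorphicVia_of_equivariant hφ RealToric.mem_AutP2 hψ hc hφ
        fun z => by simp
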